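/- Let $d\ge 1$, $\kappa\ge 0$, and let $w=(v_-,v_+)$ be a field on $\mathbb Z^d$ with annihilation rates $v_-(x)\in[0,\infty]$ and branching rates $v_+(x)\in[0,\infty)$. Put $\mathcal G=\{x: v_-(x)=\infty\}$, let $\Omega_0^w$ be the set of $\eta:\mathbb Z^d\to\mathbb N$ with finite support and $\eta=0$ on $\mathcal G$, and let $\nu$ be a probability measure on $\Omega_0^w$. Let $\Lambda_n=\{x:\max_i|x_i|\le n\}$ and let $|\cdot|$ be the Euclidean norm. For $\eta\in\Omega_0^w$, $\eta^{x,y}$, $\eta^{x,-}$, $\eta^{x,+}$ denote $\eta$ after one particle has jumped from $x$ to $y$, one particle has been removed at $x$, one particle has been added at $x$. For finite $U\subset\mathbb Z^d$ let $$L_Uf(\eta)=\sum_{x\in U\setminus\mathcal G}\Big[\sum_{y\notin\mathcal G,|x-y|=1}\kappa\eta(x)(f(\eta^{x,y})-f(\eta))+\sum_{y\in\mathcal G,|x-y|=1}\kappa\eta(x)(f(\eta^{x,-})-f(\eta))+v_+(x)\eta(x)(f(\eta^{x,+})-f(\eta))\Big]+\sum_{x\notin\mathcal G}v_-(x)\eta(x)(f(\eta^{x,-})-f(\eta)).$$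 The reaction–diffusion process on $U$ with field $w$ and initial law $\nu$ is the càdlàg $\Omega_0^w$-valued Markov process with generator $L_U$ started from $\nu$ (as the solution of the martingale problem for all bounded $f$ with $L_Uf$ bounded). Let $(\eta^n)_{n\ge1}$ be processes on one probability space with law $Q_\nu^w$ (expectation $E_\nu^w$) such that for every $n\ge 1$: (i) $\eta^n$ is a reaction–diffusion process on $\Lambda_n$ with field $w$ and initial law $\nu$; (ii) for every $t\ge0$, almost surely $\eta^{n+1}(t,x)\ge\eta^n(t,x)$ for all $x\in\Lambda_n$; (iii) for every $t\ge0$, almost surely $\eta^n(t)=\eta^{n+1}(t)$ on $\{T_n>t\}$, where $T_n=\inf\{t\ge 0:\exists x\notin\Lambda_n,\ \eta^n(t,x)>0\}$. The infinite-volume reaction–diffusion process is $\eta(t,x)=\lim_{n\to\infty}\eta^n(t,x)\in\mathbb N\cup\{\infty\}$, and $\zeta(t)=\sum_{x\in\mathbb Z^d}\eta(t,x)$ is the total number of particles. Assume that $$\limsup_{|x|\to\infty}\frac{v_+(x)}{|x|\log|x|}=0 .$$ Then: (a) for every $t\ge0$ and every finite configuration $\xi$, $E_\nu^w[\zeta(t);\,\eta(0)=\xi]<\infty$,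 i.e. given the initial configuration the expected total number of particles is finite; (b) if moreover $\nu$ is concentrated on configurations that vanish outside some fixed box and $\int\sum_x\xi(x)\,\nu(d\xi)<\infty$ (in particular if $\nu$ is a point mass), then $E_\nu^w[\zeta(t)]<\infty$ for every $t\ge0$; (c) there is no explosion: $Q_\nu^w[\eta(t,x)<\infty\ \text{for all } x\in\mathbb Z^d,\ t\ge0]=1$. -/

import Mathlib

open MeasureTheory ProbabilityTheory Filter Topology
open scoped NNReal ENNReal

noncomputable section

namespace ReactionDiffusion

/-- The lattice `ℤ^d`. -/
abbrev Site (d : ℕ) := Fin d → ℤ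

/-- Euclidean norm `|x|` of a lattice site. -/
def euclNorm {d : ℕ} (x : Site d) : ℝ := Real.sqrt (∑ i, (x i : ℝ) ^ 2)

/-- The box `Λ_n = {x : max_i |x_i| ≤ n}`. -/
def box (d n : ℕ) : Finset (Site d) := Finset.Icc (fun _ => -(n : ℤ)) (fun _ => (n : ℤ))

/-- The `2d` nearest neighbours of `x`, i.e. the sites at Euclidean distance `1`. -/
def neighbors {d : ℕ} (x : Site d) : Finset (Site d) :=
  (Finset.Icc (x - 1) (x + 1)).filter (fun y => ∑ i, (y i - x i) ^ 2 = 1)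

/-- A field configuration: annihilation rates `v_-(x) ∈ [0,∞]` and branching rates
`v_+(x) ∈ [0,∞)`. -/
structure Field (d : ℕ) where
  vMinus : Site d → ℝ≥0∞
  vPlus : Site d → ℝ≥0

/-- The set of hard core obstacle sites. -/
def Field.obstacles {d : ℕ} (w : Field d) : Set (Site d) := {x | w.vMinus x = ⊤}

/-- Configurations with finitely many particles. -/
abbrev Config (d : ℕ) := Site d →₀ ℕ

/-- The set of configurations is countable; its Borel `σ`-algebra (for the topology of
coordinatewise convergence) consists of all subsets. -/
instance instMeasurableSpaceConfig (d : ℕ) : MeasurableSpace (Config d) := ⊤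

/-- The state space: finite configurations without particles on the hard core obstacles. -/
def Field.states {d : ℕ} (w : Field d) : Set (Config d) := {η | ∀ x ∈ w.obstacles, η x = 0}

/-- `η^{x,+}`: one extra particle at `x`. -/
def Config.add {d : ℕ} (η : Config d) (x : Site d) : Config d := η + Finsupp.single x 1

/-- `η^{x,-}`: one particle at `x` is removed. -/
def Config.remove {d : ℕ} (η : Config d) (x : Site d) : Config d := η - Finsupp.single x 1

/-- `η^{x,y}`: one particle has jumped from `x` to `y`. -/
def Config.jump {d : ℕ} (η : Config d) (x y : Site d) : Config d :=
  η - Finsupp.single x 1 + Finsupp.single y 1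

open Classical in
/-- The generator `L_U` of the reaction-diffusion process on the finite set `U`. In `U` particles
jump to each nearest neighbour at rate `κ` (and disappear if it is an obstacle) and branch at rate
`v_+`; everywhere particles are annihilated at rate `v_-`. (The last sum, over all non-obstacle
sites, is written over the finitely many occupied ones.) -/
def generator {d : ℕ} (κ : ℝ≥0) (w : Field d) (U : Finset (Site d)) (f : Config d → ℝ)
    (η : Config d) : ℝ :=
  (∑ x ∈ U with x ∉ w.obstacles, ∑ y ∈ neighbors x with y ∉ w.obstacles,
      (κ : ℝ) * η x * (f (η.jump x y) - f η))
  + (∑ x ∈ U with x ∉ w.obstacles, ∑ y ∈ neighbors x with y ∈ w.obstacles,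
      (κ : ℝ) * η x * (f (η.remove x) - f η))
  + (∑ x ∈ U with x ∉ w.obstacles, (w.vPlus x : ℝ) * η x * (f (η.add x) - f η))
  + (∑ x ∈ η.support with x ∉ w.obstacles,
      (w.vMinus x).toReal * η x * (f (η.remove x) - f η))

/-- The domain on which the generator acts: bounded functions `f` on the state space for which
`L_U f` is bounded on the state space. -/
def domain {d : ℕ} (κ : ℝ≥0) (w : Field d) (U : Finset (Site d)) : Set (Config d → ℝ) :=
  {f | ∃ C : ℝ, ∀ η ∈ w.states, |f η| ≤ C ∧ |generator κ w U f η| ≤ C}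

variable {Ω : Type*} [MeasurableSpace Ω]

/-- The filtration generated by a process with values in the configurations. -/
def history {d : ℕ} (X : ℝ≥0 → Ω → Config d) (hX : ∀ t, Measurable (X t)) :
    Filtration ℝ≥0 (inferInstance : MeasurableSpace Ω) where
  seq t := ⨆ s ≤ t, MeasurableSpace.comap (X s) (instMeasurableSpaceConfig d)
  mono' _ _ hst := iSup₂_mono' fun r hr => ⟨r, hr.trans hst, le_rfl⟩
  le' _ := iSup₂_le fun s _ => (hX s).comap_le

/-- `X` is (a version of) the reaction-diffusion process on the finite set `U` with field `w` and
initial law `ν`: a process with càdlàg paths in the state space (for the topology of coordinatewise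
convergence) and `X 0` of law `ν`, that solves the martingale problem for the generator `L_U`. -/
structure IsProcessOn {d : ℕ} (κ : ℝ≥0) (w : Field d) (U : Finset (Site d))
    (ν : Measure (Config d)) (P : Measure Ω) (X : ℝ≥0 → Ω → Config d) : Prop where
  measurable : ∀ t, Measurable (X t)
  mem_states : ∀ t ω, X t ω ∈ w.states
  right_continuous : ∀ ω t x, ∀ᶠ s in 𝓝[>] t, X s ω x = X t ω x
  left_limits : ∀ ω t, ∃ ξ ∈ w.states, ∀ x, ∀ᶠ s in 𝓝[<] t, X s ω x = ξ x
  initial : P.map (X 0) = ν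
  martingale : ∀ f ∈ domain κ w U,
    Martingale (fun (t : ℝ≥0) ω =>
      f (X t ω) - ∫ s in (0 : ℝ)..t, generator κ w U f (X s.toNNReal ω)) (history X measurable) P

/-- The first time at which there is a particle outside of `Λ_n`. -/
def exitTime {d : ℕ} (n : ℕ) (X : ℝ≥0 → Ω → Config d) (ω : Ω) : ℝ≥0∞ :=
  ⨅ (t : ℝ≥0) (_ : ∃ x ∉ box d n, 0 < X t ω x), (t : ℝ≥0∞)

/-- The sequence `η^n` (`n ≥ 1`), defined on one probability space `(Ω, Q)`, is a natural coupling
of the reaction-diffusion processes on the boxes `Λ_n`, with field `w` and initial law `ν`. -/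
structure IsNaturalCoupling {d : ℕ} (κ : ℝ≥0) (w : Field d) (ν : Measure (Config d))
    (Q : Measure Ω) (η : ℕ → ℝ≥0 → Ω → Config d) : Prop where
  isProcessOn : ∀ n, 1 ≤ n → IsProcessOn κ w (box d n) ν Q (η n)
  monotone : ∀ n, 1 ≤ n → ∀ t, ∀ᵐ ω ∂Q, ∀ x ∈ box d n, η n t ω x ≤ η (n + 1) t ω x
  eq_of_lt_exitTime : ∀ n, 1 ≤ n → ∀ t : ℝ≥0, ∀ᵐ ω ∂Q,
    (t : ℝ≥0∞) < exitTime n (η n) ω → η n t ω = η (n + 1) t ω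

/-- The infinite-volume reaction-diffusion process `η(t,x) = lim_n η^n(t,x) ∈ ℕ ∪ {∞}`. (For a
natural coupling the sequence is almost surely nondecreasing from some `n` on, so that the limit
exists and is the upper limit.) -/
def limitProcess {d : ℕ} (η : ℕ → ℝ≥0 → Ω → Config d) (t : ℝ≥0) (ω : Ω) (x : Site d) : ℕ∞ :=
  limsup (fun n => (η n t ω x : ℕ∞)) atTop

/-- The total number of particles `ζ(t)` of the infinite-volume process. -/
def totalNumber {d : ℕ} (η : ℕ → ℝ≥0 → Ω → Config d) (t : ℝ≥0) (ω : Ω) : ℝ≥0∞ :=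
  ∑' x, (limitProcess η t ω x : ℝ≥0∞)

/-- With probability one the number of particles at each site is finite, at all times. -/
def NoExplosion {d : ℕ} (Q : Measure Ω) (η : ℕ → ℝ≥0 → Ω → Config d) : Prop :=
  ∀ᵐ ω ∂Q, ∀ x t, limitProcess η t ω x < ⊤

end ReactionDiffusion

end

/-!
The expected particle numbers are bounded by a supersolution of the dual linear equation, built
from `q(x) = K + 2 ε (|x| + 2) log (|x| + 2)`. Going to a neighbour raises `q` by at most
`2 ε (1 + log (|x| + 3))`, so for `s ≤ T` and `4 ε T ≤ 1` the function `h_s(x) = e^{s q(x)}`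
grows by a factor of order at most `√|x|`. As `v_+` is `o(|x| log |x|)`, this gives
`∂_s h_s = q h_s ≥ κ ∑_{y ∼ x} h_s(y) + v_+ h_s` for `K` large (`exists_isGrowthRate`). Hence, for
the process `X` on any finite set `U`, the weighted particle number
`H_{T-t}(X_t) = ∑_{x ∈ U} h_{T-t}(x) X_t(x)` ought to be a supermartingale, which bounds the
expected number of particles at time `T` by `H_T(X_0)`, uniformly in `U`.

The martingale problem is only given for bounded functions with bounded image under the generator,
and linear functions are not of this kind. The functions `e^{-θ H}` and their derivatives in `s`
are: they depend on the configuration in `U` only and decay faster than the inverse of the number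
of particles (`mem_domain_of_decay`). By convexity, `L e^{-θ H} ≥ -θ (∂_s H) e^{-θ H}`, so that
`E[e^{-θ H_{T-t}(X_t)}; A]` can decrease in a time step only to second order
(`IsProcessOn.laplace_step`), and hence is nondecreasing. Letting `θ → 0` yields the supermartingale
inequality for `H` (`IsProcessOn.supermartingale`), and from it a maximal inequality
(`IsProcessOn.maximal_seq`).

For a natural coupling, the total number of particles is the increasing limit of the numbers of
particles in `Λ_n` of the processes on `Λ_n`. Monotone convergence therefore transfers the uniform
bound to the infinite-volume process, once it is known that the initial configurations of all
`η^n` coincide on `Λ_n` (`IsNaturalCoupling.ae_initial_eq`). For the absence of explosion, the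
maximal inequality on the event that `H_T` of the initial configuration is at most `J` bounds the
probability that some `η^n(t, x)`, `t < T`, reaches the level `c` by `ν(H_T > J) + J / c`; this
tends to `0` when first `c` and then `J` tends to infinity.
-/

noncomputable section

namespace ReactionDiffusion

/-! ### Local functions and the generator -/

/-- The weighted particle number `∑_{x ∈ U} h(x) η(x)`. -/
def weight {d : ℕ} (h : Site d → ℝ) (U : Finset (Site d)) (η : Config d) : ℝ :=
  ∑ x ∈ U, h x * η x

/-- `f` depends on a configuration only through its restriction to `U`. -/
def IsLocalOn {d : ℕ} {α : Type*} (U : Finset (Site d)) (f : Config d → α) : Prop :=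
  ∀ ⦃η η' : Config d⦄, (∀ x ∈ U, η x = η' x) → f η = f η'

/-- A bound on the total rate, per particle in `U`, of the transitions seen from `U`. -/
def rateBound {d : ℕ} (κ : ℝ≥0) (w : Field d) (U : Finset (Site d)) : ℝ :=
  ∑ x ∈ U, (2 * (κ : ℝ) * (neighbors x).card + w.vPlus x + (w.vMinus x).toReal)

section Deterministic

variable {d : ℕ} {κ : ℝ≥0} {w : Field d} {U : Finset (Site d)}

lemma isLocalOn_weight (h : Site d → ℝ) : IsLocalOn U (weight h U) := fun η η' hη =>
  Finset.sum_congr rfl fun x hx => by rw [hη x hx]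

lemma weight_nonneg {h : Site d → ℝ} (hh : ∀ x, 0 ≤ h x) (η : Config d) : 0 ≤ weight h U η :=
  Finset.sum_nonneg fun x _ => mul_nonneg (hh x) (Nat.cast_nonneg _)

lemma weight_mono {h h' : Site d → ℝ} (hh : ∀ x ∈ U, h x ≤ h' x) (η : Config d) :
    weight h U η ≤ weight h' U η :=
  Finset.sum_le_sum fun x hx => mul_le_mul_of_nonneg_right (hh x hx) (Nat.cast_nonneg _)

lemma mul_apply_le_weight {h : Site d → ℝ} (hh : ∀ x, 0 ≤ h x) (η : Config d) {x : Site d}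
    (hx : x ∈ U) : h x * η x ≤ weight h U η :=
  Finset.single_le_sum (f := fun x => h x * (η x : ℝ))
    (fun x _ => mul_nonneg (hh x) (Nat.cast_nonneg _)) hx

lemma weight_const_mul (c : ℝ) (h : Site d → ℝ) (η : Config d) :
    weight (fun x => c * h x) U η = c * weight h U η := by
  simp [weight, Finset.mul_sum, mul_assoc]

lemma remove_apply_le (η : Config d) (x y : Site d) : η.remove x y ≤ η y := by
  simp [Config.remove, Finsupp.tsub_apply]

lemma weight_remove_le {h : Site d → ℝ} (hh : ∀ x, 0 ≤ h x) (η : Config d) (x : Site d) :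
    weight h U (η.remove x) ≤ weight h U η :=
  Finset.sum_le_sum fun y _ => mul_le_mul_of_nonneg_left
    (by exact_mod_cast remove_apply_le η x y) (hh y)

lemma weight_add_single_le {h : Site d → ℝ} (hh : ∀ x, 0 ≤ h x) (η : Config d) (x : Site d) :
    weight h U (η + Finsupp.single x 1) ≤ weight h U η + h x := by
  have : weight h U (η + Finsupp.single x 1) = weight h U η + ∑ y ∈ U, if x = y then h y else 0 := by
    rw [weight, weight, ← Finset.sum_add_distrib]
    refine Finset.sum_congr rfl fun y _ => ?_
    by_cases hxy : x = y <;> simp [hxy, mul_add]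
  rw [this, Finset.sum_ite_eq]
  split_ifs
  · exact le_rfl
  · linarith [hh x]

lemma weight_add_le {h : Site d → ℝ} (hh : ∀ x, 0 ≤ h x) (η : Config d) (x : Site d) :
    weight h U (η.add x) ≤ weight h U η + h x := weight_add_single_le hh η x

lemma weight_jump_le {h : Site d → ℝ} (hh : ∀ x, 0 ≤ h x) (η : Config d) (x y : Site d) :
    weight h U (η.jump x y) ≤ weight h U η + h y :=
  (weight_add_single_le hh (η.remove x) y).trans
    (by linarith [weight_remove_le (U := U) hh η x])

lemma weight_one_le_remove (η : Config d) (x : Site d) :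
    weight 1 U η ≤ 1 + weight 1 U (η.remove x) := by
  have h1 : η ≤ η.remove x + Finsupp.single x 1 := by
    rw [Config.remove]; exact le_tsub_add
  have h2 : weight 1 U η ≤ weight 1 U (η.remove x + Finsupp.single x 1) :=
    Finset.sum_le_sum fun y _ => mul_le_mul_of_nonneg_left (by exact_mod_cast h1 y) zero_le_one
  have h3 := weight_add_single_le (U := U) (h := 1) (fun _ => zero_le_one) (η.remove x) x
  simp only [Pi.one_apply] at h3
  linarith

lemma weight_one_le_add_single (η : Config d) (x : Site d) :
    weight 1 U η ≤ weight 1 U (η + Finsupp.single x 1) :=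
  Finset.sum_le_sum fun y _ => mul_le_mul_of_nonneg_left (by simp) zero_le_one

lemma weight_one_le_add (η : Config d) (x : Site d) :
    weight 1 U η ≤ 1 + weight 1 U (η.add x) := by
  have := weight_one_le_add_single (U := U) η x
  rw [Config.add]; linarith

lemma weight_one_le_jump (η : Config d) (x y : Site d) :
    weight 1 U η ≤ 1 + weight 1 U (η.jump x y) := by
  have h1 := weight_one_le_remove (U := U) η x
  have h2 := weight_one_le_add_single (U := U) (η.remove x) y
  rw [Config.remove] at h1 h2
  rw [Config.jump]; linarith

open Classical in
/-- On functions that are local on `U`, only the annihilations in `U` are seen. -/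
lemma generator_eq_of_isLocalOn {f : Config d → ℝ} (hf : IsLocalOn U f) (η : Config d) :
    generator κ w U f η =
      (∑ x ∈ U with x ∉ w.obstacles, ∑ y ∈ neighbors x with y ∉ w.obstacles,
          (κ : ℝ) * η x * (f (η.jump x y) - f η))
      + (∑ x ∈ U with x ∉ w.obstacles, ∑ y ∈ neighbors x with y ∈ w.obstacles,
          (κ : ℝ) * η x * (f (η.remove x) - f η))
      + (∑ x ∈ U with x ∉ w.obstacles, (w.vPlus x : ℝ) * η x * (f (η.add x) - f η))
      + (∑ x ∈ U with x ∉ w.obstacles,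
          (w.vMinus x).toReal * η x * (f (η.remove x) - f η)) := by
  rw [generator]
  congr 1
  rw [← Finset.sum_subset (s₁ := (U ∩ η.support).filter (· ∉ w.obstacles))
      (s₂ := η.support.filter (· ∉ w.obstacles)),
    ← Finset.sum_subset (s₁ := (U ∩ η.support).filter (· ∉ w.obstacles))
      (s₂ := U.filter (· ∉ w.obstacles))]
  · exact Finset.filter_subset_filter _ Finset.inter_subset_left
  · intro x hx hx'
    have : η x = 0 := by
      simp only [Finset.mem_filter, Finset.mem_inter, Finsupp.mem_support_iff] at hx hx'
      tauto
    simp [this]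
  · exact Finset.filter_subset_filter _ Finset.inter_subset_right
  · intro x hx hx'
    have hxU : x ∉ U := by
      simp only [Finset.mem_filter, Finset.mem_inter, Finsupp.mem_support_iff] at hx hx'
      tauto
    have : f (η.remove x) = f η := hf fun y hy => by
      have : x ≠ y := fun h => hxU (h ▸ hy)
      simp [Config.remove, Finsupp.tsub_apply, this]
    simp [this]

lemma isLocalOn_generator {f : Config d → ℝ} (hf : IsLocalOn U f) :
    IsLocalOn U (generator κ w U f) := by
  classical
  intro η η' h
  have hr : ∀ x, f (η.remove x) = f (η'.remove x) := fun x => hf fun z hz => by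
    simp [Config.remove, Finsupp.tsub_apply, h z hz]
  have ha : ∀ x, f (η.add x) = f (η'.add x) := fun x => hf fun z hz => by
    simp [Config.add, h z hz]
  have hj : ∀ x y, f (η.jump x y) = f (η'.jump x y) := fun x y => hf fun z hz => by
    simp [Config.jump, h z hz]
  rw [generator_eq_of_isLocalOn hf, generator_eq_of_isLocalOn hf]
  simp only [hr, ha, hj, hf h]
  congr 1
  · congr 1
    · congr 1 <;>
      exact Finset.sum_congr rfl fun x hx => by rw [h x (Finset.mem_filter.1 hx).1]
    · exact Finset.sum_congr rfl fun x hx => by rw [h x (Finset.mem_filter.1 hx).1]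
  · exact Finset.sum_congr rfl fun x hx => by rw [h x (Finset.mem_filter.1 hx).1]

/-- The transition rates grow linearly in the number of particles in `U`, and a transition lowers
this number by at most one; a local function that decays like the inverse of this number is thus
mapped to a bounded function. -/
lemma abs_generator_le {f : Config d → ℝ} (hf : IsLocalOn U f) {K : ℝ}
    (hK : ∀ η, |f η| * (1 + weight 1 U η) ≤ K) (η : Config d) :
    |generator κ w U f η| ≤ 2 * K * rateBound κ w U := by
  classical
  have h1 : ∀ ζ : Config d, 0 ≤ weight 1 U ζ := weight_nonneg fun _ => zero_le_one
  have key : ∀ x ∈ U, ∀ η' : Config d, weight 1 U η ≤ 1 + weight 1 U η' →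
      ∀ c : ℝ, 0 ≤ c → |c * η x * (f η' - f η)| ≤ c * (2 * K) := by
    intro x hx η' hη' c hc
    have hx' : (η x : ℝ) ≤ weight 1 U η := by
      simpa using mul_apply_le_weight (h := 1) (fun _ => zero_le_one) η hx
    have e1 : (η x : ℝ) * |f η'| ≤ K := by
      refine le_trans ?_ (hK η')
      rw [mul_comm]
      exact mul_le_mul_of_nonneg_left (by linarith) (abs_nonneg _)
    have e2 : (η x : ℝ) * |f η| ≤ K := by
      refine le_trans ?_ (hK η)
      rw [mul_comm]
      exact mul_le_mul_of_nonneg_left (by linarith) (abs_nonneg _)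
    rw [mul_assoc, abs_mul, abs_mul, abs_of_nonneg hc, abs_of_nonneg (Nat.cast_nonneg (η x))]
    refine mul_le_mul_of_nonneg_left ?_ hc
    calc (η x : ℝ) * |f η' - f η| ≤ η x * (|f η'| + |f η|) :=
          mul_le_mul_of_nonneg_left (abs_sub _ _) (Nat.cast_nonneg _)
      _ ≤ 2 * K := by linarith
  have hK0 : 0 ≤ K := le_trans (mul_nonneg (abs_nonneg _) (by linarith [h1 0])) (hK 0)
  have inner : ∀ x ∈ U, ∀ (p : Site d → Prop) [DecidablePred p] (g : Site d → ℝ),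
      (∀ y, |g y| ≤ κ * (2 * K)) →
      |∑ y ∈ neighbors x with p y, g y| ≤ (neighbors x).card * (κ * (2 * K)) := by
    intro x _ p _ g hg
    refine (Finset.abs_sum_le_sum_abs _ _).trans ?_
    refine (Finset.sum_le_card_nsmul _ _ _ fun y _ => hg y).trans ?_
    rw [nsmul_eq_mul]
    gcongr
    exact Finset.filter_subset _ _
  have outer : ∀ (g B : Site d → ℝ), (∀ x ∈ U, |g x| ≤ B x) →
      |∑ x ∈ U with x ∉ w.obstacles, g x| ≤ ∑ x ∈ U, B x := by
    intro g B hg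
    refine (Finset.abs_sum_le_sum_abs _ _).trans ?_
    refine (Finset.sum_le_sum_of_subset_of_nonneg (Finset.filter_subset _ _)
      fun x _ _ => abs_nonneg _).trans (Finset.sum_le_sum hg)
  rw [generator_eq_of_isLocalOn hf]
  have a1 := outer (fun x => ∑ y ∈ neighbors x with y ∉ w.obstacles,
      (κ : ℝ) * η x * (f (η.jump x y) - f η)) _
    fun x hx => inner x hx _ _ fun y => key x hx _ (weight_one_le_jump η x y) _ κ.2
  have a2 := outer (fun x => ∑ y ∈ neighbors x with y ∈ w.obstacles,
      (κ : ℝ) * η x * (f (η.remove x) - f η)) _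
    fun x hx => inner x hx _ _ fun y => key x hx _ (weight_one_le_remove η x) _ κ.2
  have a3 := outer (fun x => (w.vPlus x : ℝ) * η x * (f (η.add x) - f η)) _
    fun x hx => key x hx _ (weight_one_le_add η x) _ (w.vPlus x).2
  have a4 := outer (fun x => (w.vMinus x).toReal * η x * (f (η.remove x) - f η)) _
    fun x hx => key x hx _ (weight_one_le_remove η x) _ ENNReal.toReal_nonneg
  have hR : 2 * K * rateBound κ w U = (∑ x ∈ U, (neighbors x).card * (κ * (2 * K)))
      + (∑ x ∈ U, (neighbors x).card * (κ * (2 * K))) + (∑ x ∈ U, (w.vPlus x : ℝ) * (2 * K))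
      + ∑ x ∈ U, (w.vMinus x).toReal * (2 * K) := by
    rw [rateBound, Finset.mul_sum, ← Finset.sum_add_distrib, ← Finset.sum_add_distrib,
      ← Finset.sum_add_distrib]
    exact Finset.sum_congr rfl fun x _ => by ring
  rw [hR]
  refine (abs_add_le _ _).trans (add_le_add ((abs_add_le _ _).trans
    (add_le_add ((abs_add_le _ _).trans (add_le_add a1 a2)) a3)) a4)

lemma mem_domain_of_decay {f : Config d → ℝ} (hf : IsLocalOn U f) {K : ℝ}
    (hK : ∀ η, |f η| * (1 + weight 1 U η) ≤ K) : f ∈ domain κ w U := by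
  refine ⟨max K (2 * K * rateBound κ w U), fun η _ => ⟨?_, ?_⟩⟩
  · refine le_max_of_le_left (le_trans ?_ (hK η))
    have := weight_nonneg (U := U) (h := 1) (fun _ => zero_le_one) η
    nlinarith [abs_nonneg (f η)]
  · exact le_max_of_le_right (abs_generator_le hf hK η)

/-- Let `H` and `D` have the weights `h` and `q h`. If the gains from jumps and branching raise `H`
at a rate of at most `D`, then `L_U e^{-H} ≥ - D e^{-H}`: since `e^{-a} - 1 ≥ -a`, and since losses
raise `e^{-H}`. -/
lemma neg_le_generator_exp_neg_weight {h q : Site d → ℝ} (hh : ∀ x, 0 ≤ h x)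
    (hq : ∀ x ∈ U, κ * ∑ y ∈ neighbors x, h y + w.vPlus x * h x ≤ q x * h x) (η : Config d) :
    -(Real.exp (-weight h U η) * weight (fun x => q x * h x) U η) ≤
      generator κ w U (fun ζ => Real.exp (-weight h U ζ)) η := by
  classical
  have hloc : IsLocalOn U (fun ζ => Real.exp (-weight h U ζ)) := fun ζ ζ' hζ => by
    simp only [isLocalOn_weight h hζ]
  rw [generator_eq_of_isLocalOn hloc]
  set E := Real.exp (-weight h U η) with hE
  have hE0 : 0 < E := Real.exp_pos _
  -- a transition that raises `H` by at most `b` lowers `e^{-H}` by at most `b e^{-H}`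
  have up : ∀ (η' : Config d) (b : ℝ), weight h U η' ≤ weight h U η + b →
      -(E * b) ≤ Real.exp (-weight h U η') - E := by
    intro η' b hb
    have h1 : E * Real.exp (-b) ≤ Real.exp (-weight h U η') := by
      rw [hE, ← Real.exp_add]; exact Real.exp_le_exp.2 (by linarith)
    have h2 := mul_le_mul_of_nonneg_left (Real.add_one_le_exp (-b)) hE0.le
    nlinarith
  have down : ∀ x, 0 ≤ Real.exp (-weight h U (η.remove x)) - E := fun x => by
    rw [hE, sub_nonneg]; exact Real.exp_le_exp.2 (neg_le_neg (weight_remove_le hh η x))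
  have b1 : ∑ x ∈ U with x ∉ w.obstacles, -(E * (κ * ∑ y ∈ neighbors x, h y) * η x) ≤
      ∑ x ∈ U with x ∉ w.obstacles, ∑ y ∈ neighbors x with y ∉ w.obstacles,
        (κ : ℝ) * η x * (Real.exp (-weight h U (η.jump x y)) - E) := by
    refine Finset.sum_le_sum fun x _ => ?_
    calc -(E * (κ * ∑ y ∈ neighbors x, h y) * η x)
        = -∑ y ∈ neighbors x, (κ : ℝ) * η x * (E * h y) := by
          rw [← Finset.mul_sum, ← Finset.mul_sum]; ring
      _ ≤ -∑ y ∈ neighbors x with y ∉ w.obstacles, (κ : ℝ) * η x * (E * h y) :=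
          neg_le_neg (Finset.sum_le_sum_of_subset_of_nonneg (Finset.filter_subset _ _)
            fun y _ _ => mul_nonneg (by positivity) (mul_nonneg hE0.le (hh y)))
      _ = ∑ y ∈ neighbors x with y ∉ w.obstacles, (κ : ℝ) * η x * (-(E * h y)) := by
          rw [← Finset.sum_neg_distrib]; exact Finset.sum_congr rfl fun y _ => by ring
      _ ≤ _ := Finset.sum_le_sum fun y _ =>
          mul_le_mul_of_nonneg_left (up _ _ (weight_jump_le hh η x y)) (by positivity)
  have b2 : 0 ≤ ∑ x ∈ U with x ∉ w.obstacles, ∑ y ∈ neighbors x with y ∈ w.obstacles,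
      (κ : ℝ) * η x * (Real.exp (-weight h U (η.remove x)) - E) :=
    Finset.sum_nonneg fun x _ => Finset.sum_nonneg fun y _ =>
      mul_nonneg (by positivity) (down x)
  have b3 : ∑ x ∈ U with x ∉ w.obstacles, -(E * (w.vPlus x * h x) * η x) ≤
      ∑ x ∈ U with x ∉ w.obstacles,
        (w.vPlus x : ℝ) * η x * (Real.exp (-weight h U (η.add x)) - E) := by
    refine Finset.sum_le_sum fun x _ => ?_
    have := mul_le_mul_of_nonneg_left (up _ _ (weight_add_le hh η x))
      (show (0 : ℝ) ≤ w.vPlus x * η x by positivity)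
    calc _ = (w.vPlus x : ℝ) * η x * (-(E * h x)) := by ring
      _ ≤ _ := this
  have b4 : 0 ≤ ∑ x ∈ U with x ∉ w.obstacles,
      (w.vMinus x).toReal * η x * (Real.exp (-weight h U (η.remove x)) - E) :=
    Finset.sum_nonneg fun x _ => mul_nonneg (by positivity) (down x)
  have b5 : -(E * weight (fun x => q x * h x) U η) ≤
      (∑ x ∈ U with x ∉ w.obstacles, -(E * (κ * ∑ y ∈ neighbors x, h y) * η x))
      + ∑ x ∈ U with x ∉ w.obstacles, -(E * (w.vPlus x * h x) * η x) := by
    rw [← Finset.sum_add_distrib, weight, Finset.mul_sum, ← Finset.sum_neg_distrib]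
    have hs : ∀ x ∈ U, -(E * (q x * h x * η x)) ≤
        -(E * (κ * ∑ y ∈ neighbors x, h y) * η x) + -(E * (w.vPlus x * h x) * η x) := by
      intro x hx
      have := mul_le_mul_of_nonneg_left (hq x hx) (show 0 ≤ E * η x by positivity)
      nlinarith
    have hneg : ∀ x ∈ U, -(E * (q x * h x * η x)) ≤ 0 := by
      intro x hx
      have h0 : 0 ≤ q x * h x := le_trans (add_nonneg (mul_nonneg κ.2
        (Finset.sum_nonneg fun y _ => hh y)) (mul_nonneg (w.vPlus x).2 (hh x))) (hq x hx)
      have : 0 ≤ E * (q x * h x * η x) := by positivity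
      linarith
    rw [← Finset.sum_filter_add_sum_filter_not U (fun x => x ∉ w.obstacles)]
    have c1 := Finset.sum_le_sum fun x (hx : x ∈ U.filter (fun x => x ∉ w.obstacles)) =>
      hs x (Finset.mem_filter.1 hx).1
    have c2 := Finset.sum_nonpos fun x (hx : x ∈ U.filter (fun x => ¬ x ∉ w.obstacles)) =>
      hneg x (Finset.mem_filter.1 hx).1
    linarith
  linarith

end Deterministic

/-! ### Path regularity and Dynkin's formula -/

/-- A process with right-continuous paths is jointly measurable: it is the limit of its values at
the next point of the grid of mesh `1 / (k + 1)`. -/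
lemma measurable_uncurry_of_tendsto_right {Ω : Type*} [MeasurableSpace Ω] {Y : ℝ≥0 → Ω → ℝ}
    (hm : ∀ t, Measurable (Y t))
    (hr : ∀ ω t, Tendsto (fun s => Y s ω) (𝓝[>] t) (𝓝 (Y t ω))) :
    Measurable fun p : ℝ≥0 × Ω => Y p.1 p.2 := by
  let g : ℕ → ℝ≥0 → ℝ≥0 := fun k t =>
    ((⌊t * ((k : ℝ≥0) + 1)⌋₊ : ℝ≥0) + 1) / ((k : ℝ≥0) + 1)
  refine measurable_of_tendsto_metrizable (f := fun k (p : ℝ≥0 × Ω) => Y (g k p.1) p.2) ?_ ?_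
  · intro k
    have h1 : Measurable fun p : ℕ × Ω => Y (((p.1 : ℝ≥0) + 1) / ((k : ℝ≥0) + 1)) p.2 :=
      measurable_from_prod_countable_right fun m => hm (((m : ℝ≥0) + 1) / ((k : ℝ≥0) + 1))
    have h2 : Measurable fun p : ℝ≥0 × Ω => (⌊p.1 * ((k : ℝ≥0) + 1)⌋₊, p.2) :=
      (Nat.measurable_floor.comp (measurable_fst.mul_const _)).prodMk measurable_snd
    simpa only [Function.comp_def] using h1.comp h2
  · rw [tendsto_pi_nhds]
    rintro ⟨t, ω⟩
    refine (hr ω t).comp (tendsto_nhdsWithin_iff.2 ⟨?_, Eventually.of_forall fun k => ?_⟩)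
    · have hlim : Tendsto (fun k : ℕ => t + 1 / ((k : ℝ≥0) + 1)) atTop (𝓝 t) := by
        simpa using tendsto_const_nhds.add (tendsto_one_div_add_atTop_nhds_zero_nat (𝕜 := ℝ≥0))
      refine tendsto_of_tendsto_of_tendsto_of_le_of_le tendsto_const_nhds hlim
        (fun k => ?_) (fun k => ?_)
      · have hk : (0 : ℝ≥0) < k + 1 := by positivity
        exact (le_div_iff₀ hk).2 (Nat.lt_floor_add_one _).le
      · have hk : (0 : ℝ≥0) < k + 1 := by positivity
        change (_ / _ : ℝ≥0) ≤ _
        rw [add_div]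
        gcongr
        exact (div_le_iff₀ hk).2 (Nat.floor_le zero_le)
    · have hk : (0 : ℝ≥0) < k + 1 := by positivity
      exact (lt_div_iff₀ hk).2 (Nat.lt_floor_add_one _)

section Paths

variable {d : ℕ} {κ : ℝ≥0} {w : Field d} {U : Finset (Site d)} {ν : Measure (Config d)}
  {Ω : Type*} [MeasurableSpace Ω] {P : Measure Ω} {X : ℝ≥0 → Ω → Config d}

lemma IsProcessOn.eventually_right (hX : IsProcessOn κ w U ν P X) {α : Type*}
    {V : Finset (Site d)} {f : Config d → α}
    (hf : IsLocalOn V f) (ω : Ω) (t : ℝ≥0) : ∀ᶠ s in 𝓝[>] t, f (X s ω) = f (X t ω) := by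
  have : ∀ᶠ s in 𝓝[>] t, ∀ x ∈ V, X s ω x = X t ω x :=
    (eventually_all_finset V).2 fun x _ => hX.right_continuous ω t x
  exact this.mono fun s hs => hf hs

lemma IsProcessOn.measurable_uncurry (hX : IsProcessOn κ w U ν P X)
    {f : Config d → ℝ} (hf : IsLocalOn U f) :
    Measurable fun p : ℝ × Ω => f (X p.1.toNNReal p.2) := by
  have h := measurable_uncurry_of_tendsto_right (Y := fun t ω => f (X t ω))
    (fun t => measurable_from_top.comp (hX.measurable t))
    (fun ω t => tendsto_nhds_of_eventually_eq (hX.eventually_right hf ω t))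
  exact h.comp ((measurable_real_toNNReal.comp measurable_fst).prodMk measurable_snd)

lemma IsProcessOn.intervalIntegrable (hX : IsProcessOn κ w U ν P X)
    {f : Config d → ℝ} (hf : IsLocalOn U f) {C : ℝ} (hC : ∀ η ∈ w.states, |f η| ≤ C)
    (ω : Ω) (a b : ℝ) :
    IntervalIntegrable (fun u : ℝ => f (X u.toNNReal ω)) volume a b := by
  refine (intervalIntegrable_const (c := C)).mono_fun
    ((hX.measurable_uncurry hf).comp measurable_prodMk_right).aestronglyMeasurable ?_
  filter_upwards with u
  exact (hC _ (hX.mem_states _ _)).trans (le_abs_self C)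

lemma IsProcessOn.integrable [IsFiniteMeasure P] (hX : IsProcessOn κ w U ν P X)
    {f : Config d → ℝ} {C : ℝ} (hC : ∀ η ∈ w.states, |f η| ≤ C) (t : ℝ≥0) :
    Integrable (fun ω => f (X t ω)) P :=
  Integrable.of_bound (C := C) (measurable_from_top.comp (hX.measurable t)).aestronglyMeasurable
    (Eventually.of_forall fun ω => hC _ (hX.mem_states t ω))

lemma IsProcessOn.integrable_prod [IsFiniteMeasure P] (hX : IsProcessOn κ w U ν P X)
    {f : Config d → ℝ} (hf : IsLocalOn U f) {C : ℝ} (hC : ∀ η ∈ w.states, |f η| ≤ C)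
    (A : Set Ω) (a b : ℝ) :
    Integrable (Function.uncurry fun (u : ℝ) (ω : Ω) => f (X u.toNNReal ω))
      ((volume.restrict (Set.uIoc a b)).prod (P.restrict A)) := by
  have : IsFiniteMeasure ((volume : Measure ℝ).restrict (Set.uIoc a b)) := ⟨by simp [Set.uIoc]⟩
  exact Integrable.of_bound (C := C) (hX.measurable_uncurry hf).aestronglyMeasurable
    (Eventually.of_forall fun p => hC _ (hX.mem_states _ _))

/-- Fubini's theorem for the time integral of a bounded local function. -/
lemma IsProcessOn.integral_swap [IsFiniteMeasure P] (hX : IsProcessOn κ w U ν P X)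
    {f : Config d → ℝ} (hf : IsLocalOn U f) {C : ℝ} (hC : ∀ η ∈ w.states, |f η| ≤ C)
    (A : Set Ω) (a b : ℝ) :
    ∫ ω in A, (∫ u in a..b, f (X u.toNNReal ω)) ∂P =
      ∫ u in a..b, (∫ ω in A, f (X u.toNNReal ω) ∂P) :=
  (intervalIntegral_integral_swap (hX.integrable_prod hf hC A a b)).symm

/-- Dynkin's formula, integrated over an event `A` of the past. -/
lemma IsProcessOn.dynkin [IsFiniteMeasure P] (hX : IsProcessOn κ w U ν P X)
    {f : Config d → ℝ} (hf : IsLocalOn U f) (hfd : f ∈ domain κ w U) {s t : ℝ≥0} (hst : s ≤ t)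
    {A : Set Ω} (hA : MeasurableSet[history X hX.measurable s] A) :
    ∫ ω in A, f (X t ω) ∂P - ∫ ω in A, f (X s ω) ∂P =
      ∫ u in (s : ℝ)..t, (∫ ω in A, generator κ w U f (X u.toNNReal ω) ∂P) := by
  obtain ⟨C, hC⟩ := hfd
  have hL := isLocalOn_generator (κ := κ) (w := w) hf
  have hCL : ∀ η ∈ w.states, |generator κ w U f η| ≤ C := fun η hη => (hC η hη).2
  have hint : ∀ r : ℝ≥0, Integrable (fun ω => f (X r ω)) (P.restrict A) := fun r =>
    (hX.integrable (fun η hη => (hC η hη).1) r).restrict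
  have hintL : ∀ a b : ℝ, Integrable
      (fun ω => ∫ u in a..b, generator κ w U f (X u.toNNReal ω)) (P.restrict A) := by
    intro a b
    have h := (hX.integrable_prod hL hCL A a b).integral_prod_right
    simp only [intervalIntegral.intervalIntegral_eq_integral_uIoc]
    exact h.smul (if a ≤ b then 1 else -1 : ℝ)
  have hmart := (hX.martingale f ⟨C, hC⟩).setIntegral_eq hst hA
  rw [integral_sub (hint s) (hintL _ _), integral_sub (hint t) (hintL _ _)] at hmart
  rw [← hX.integral_swap hL hCL]
  have hadd : ∫ ω in A, (∫ u in (s : ℝ)..t, generator κ w U f (X u.toNNReal ω)) ∂P =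
      ∫ ω in A, (∫ u in (0 : ℝ)..t, generator κ w U f (X u.toNNReal ω)) ∂P -
      ∫ ω in A, (∫ u in (0 : ℝ)..s, generator κ w U f (X u.toNNReal ω)) ∂P := by
    rw [← integral_sub (hintL _ _) (hintL _ _)]
    refine integral_congr_ae (Eventually.of_forall fun ω => ?_)
    exact (intervalIntegral.integral_interval_sub_left
      (hX.intervalIntegrable hL hCL ω _ _) (hX.intervalIntegrable hL hCL ω _ _)).symm
  rw [hadd]
  linarith

end Paths

/-! ### The exponential supersolution and the supermartingale inequality -/

/-- The weights `θ e^{s q(x)}`, where `s` is the time to go. -/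
def expWeight {d : ℕ} (θ : ℝ) (q : Site d → ℝ) (s : ℝ) (x : Site d) : ℝ := θ * Real.exp (s * q x)

/-- `q` is such that `(s, x) ↦ e^{s q(x)}` is, for `0 ≤ s ≤ T`, a supersolution of
`∂_s h(s, x) = κ ∑_{y ∼ x} h(s, y) + v_+(x) h(s, x)`. -/
structure IsGrowthRate {d : ℕ} (κ : ℝ≥0) (w : Field d) (T : ℝ) (q : Site d → ℝ) : Prop where
  nonneg : ∀ x, 0 ≤ q x
  supersolution : ∀ x, ∀ s, 0 ≤ s → s ≤ T →
    κ * ∑ y ∈ neighbors x, Real.exp (s * q y) + w.vPlus x * Real.exp (s * q x) ≤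
      q x * Real.exp (s * q x)

section Elementary

lemma exp_neg_le_quadratic {x : ℝ} (hx : 0 ≤ x) : Real.exp (-x) ≤ 1 - x + x ^ 2 := by
  rw [Real.exp_neg, inv_le_comm₀ (Real.exp_pos _) (by nlinarith)]
  refine le_trans ?_ (Real.add_one_le_exp x)
  rw [inv_le_iff_one_le_mul₀ (by nlinarith)]
  nlinarith [pow_nonneg hx 3]

lemma exp_neg_mul_self_le {x : ℝ} : Real.exp (-x) * x ≤ 1 := by
  rw [Real.exp_neg, inv_mul_le_iff₀ (Real.exp_pos _)]
  linarith [Real.add_one_le_exp x]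

lemma exp_neg_mul_sq_le {x : ℝ} (hx : 0 ≤ x) : Real.exp (-x) * x ^ 2 ≤ 2 := by
  rw [Real.exp_neg, inv_mul_le_iff₀ (Real.exp_pos _)]
  linarith [Real.quadratic_le_exp_of_nonneg hx]

/-- A function that decreases by at most `C (r - s) ^ 2` between `s` and `r` does not decrease. -/
lemma le_of_sub_le_sq {F : ℝ → ℝ} {a b C : ℝ} (hab : a ≤ b)
    (h : ∀ s r, a ≤ s → s ≤ r → r ≤ b → F s - F r ≤ C * (r - s) ^ 2) : F a ≤ F b := by
  have key : ∀ N : ℕ, F a - F b ≤ C * (b - a) ^ 2 * (1 / ((N : ℝ) + 1)) := by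
    intro N
    have hN : (0 : ℝ) < N + 1 := by positivity
    set δ := (b - a) / (N + 1) with hδ
    have hδ0 : 0 ≤ δ := div_nonneg (by linarith) hN.le
    have hδN : (N + 1) * δ = b - a := by rw [hδ]; field_simp
    have step : ∀ k : ℕ, k ≤ N + 1 → F a - F (a + k * δ) ≤ k * (C * δ ^ 2) := by
      intro k
      induction k with
      | zero => simp
      | succ k ih =>
        intro hk
        have hk' : ((k + 1 : ℕ) : ℝ) ≤ N + 1 := by exact_mod_cast hk
        have h1 := h (a + k * δ) (a + (k + 1 : ℕ) * δ) (by
          have : 0 ≤ (k : ℝ) * δ := by positivity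
          linarith) (by push_cast; nlinarith) (by nlinarith)
        have h2 := ih (by omega)
        have h3 : a + ((k + 1 : ℕ) : ℝ) * δ - (a + k * δ) = δ := by push_cast; ring
        rw [h3] at h1
        push_cast at h1 ⊢
        linarith
    have h1 := step (N + 1) le_rfl
    have h2 : a + ((N + 1 : ℕ) : ℝ) * δ = b := by push_cast; linarith
    rw [h2] at h1
    refine h1.trans (le_of_eq ?_)
    rw [hδ]; push_cast; field_simp
  have hlim : Tendsto (fun N : ℕ => C * (b - a) ^ 2 * (1 / ((N : ℝ) + 1))) atTop
      (𝓝 (C * (b - a) ^ 2 * 0)) := tendsto_one_div_add_atTop_nhds_zero_nat.const_mul _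
  have := ge_of_tendsto' hlim key
  linarith

end Elementary

section Supermartingale

variable {d : ℕ} {κ : ℝ≥0} {w : Field d} {U : Finset (Site d)} {q : Site d → ℝ} {θ : ℝ}

lemma expWeight_nonneg (hθ : 0 ≤ θ) (s : ℝ) (x : Site d) : 0 ≤ expWeight θ q s x :=
  mul_nonneg hθ (Real.exp_pos _).le

lemma le_expWeight (hθ : 0 ≤ θ) {s : ℝ} (hs : 0 ≤ s) {x : Site d} (hq : 0 ≤ q x) :
    θ ≤ expWeight θ q s x :=
  le_mul_of_one_le_right hθ (Real.one_le_exp (mul_nonneg hs hq))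

lemma weight_expWeight (s : ℝ) (η : Config d) :
    weight (expWeight θ q s) U η = θ * weight (expWeight 1 q s) U η := by
  rw [← weight_const_mul]; congr 1; funext x; simp [expWeight]

/-- The derivative in `s` of the weight with coefficients `θ e^{s q}`. -/
def expWeightDeriv {d : ℕ} (θ : ℝ) (q : Site d → ℝ) (s : ℝ) (U : Finset (Site d))
    (η : Config d) : ℝ := weight (fun x => q x * expWeight θ q s x) U η

lemma expWeightDeriv_nonneg (hθ : 0 ≤ θ) (hq : ∀ x, 0 ≤ q x) (s : ℝ) (η : Config d) :
    0 ≤ expWeightDeriv θ q s U η :=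
  weight_nonneg (fun x => mul_nonneg (hq x) (expWeight_nonneg hθ s x)) η

lemma expWeightDeriv_le (hθ : 0 ≤ θ) (hq : ∀ x, 0 ≤ q x) (s : ℝ) (η : Config d) :
    expWeightDeriv θ q s U η ≤ (∑ x ∈ U, q x) * weight (expWeight θ q s) U η := by
  rw [expWeightDeriv, ← weight_const_mul]
  exact weight_mono (fun x hx => mul_le_mul_of_nonneg_right
    (Finset.single_le_sum (fun y _ => hq y) hx) (expWeight_nonneg hθ s x)) η

lemma mul_weight_one_le (hθ : 0 ≤ θ) (hq : ∀ x, 0 ≤ q x) {s : ℝ} (hs : 0 ≤ s) (η : Config d) :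
    θ * weight 1 U η ≤ weight (expWeight θ q s) U η := by
  rw [← weight_const_mul]
  exact weight_mono (fun x _ => by simpa using le_expWeight hθ hs (hq x)) η

lemma exp_neg_weight_decay (hθ : 0 < θ) (hq : ∀ x, 0 ≤ q x) {s : ℝ} (hs : 0 ≤ s)
    (η : Config d) :
    |Real.exp (-weight (expWeight θ q s) U η)| * (1 + weight 1 U η) ≤ 1 + 1 / θ := by
  have h1 := mul_weight_one_le (U := U) hθ.le hq hs η
  have h0 := weight_nonneg (U := U) (expWeight_nonneg (q := q) hθ.le s) η
  set H := weight (expWeight θ q s) U η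
  have h2 : weight 1 U η ≤ H * (1 / θ) := by
    rw [mul_one_div, le_div_iff₀ hθ]; linarith
  have h3 : Real.exp (-H) ≤ 1 := Real.exp_le_one_iff.2 (by linarith)
  rw [abs_of_pos (Real.exp_pos _)]
  calc Real.exp (-H) * (1 + weight 1 U η) ≤ Real.exp (-H) * (1 + H * (1 / θ)) := by gcongr
    _ = Real.exp (-H) + (Real.exp (-H) * H) * (1 / θ) := by ring
    _ ≤ 1 + 1 * (1 / θ) := by gcongr; exact exp_neg_mul_self_le
    _ = _ := by ring

lemma exp_neg_weight_mul_deriv_decay (hθ : 0 < θ) (hq : ∀ x, 0 ≤ q x) {s : ℝ} (hs : 0 ≤ s)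
    (η : Config d) :
    |Real.exp (-weight (expWeight θ q s) U η) * expWeightDeriv θ q s U η| *
      (1 + weight 1 U η) ≤ (∑ x ∈ U, q x) * (1 + 2 * (1 / θ)) := by
  have h1 := mul_weight_one_le (U := U) hθ.le hq hs η
  have h0 := weight_nonneg (U := U) (expWeight_nonneg (q := q) hθ.le s) η
  have hD := expWeightDeriv_le (U := U) hθ.le hq s η
  have hD0 := expWeightDeriv_nonneg (U := U) hθ.le hq s η
  have hQ : 0 ≤ ∑ x ∈ U, q x := Finset.sum_nonneg fun x _ => hq x
  set H := weight (expWeight θ q s) U η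
  have h2 : weight 1 U η ≤ H * (1 / θ) := by
    rw [mul_one_div, le_div_iff₀ hθ]; linarith
  rw [abs_of_nonneg (mul_nonneg (Real.exp_pos _).le hD0)]
  calc Real.exp (-H) * expWeightDeriv θ q s U η * (1 + weight 1 U η)
      ≤ Real.exp (-H) * ((∑ x ∈ U, q x) * H) * (1 + H * (1 / θ)) := by
        have := weight_nonneg (U := U) (h := 1) (fun _ => zero_le_one) η
        gcongr
    _ = (∑ x ∈ U, q x) * (Real.exp (-H) * H + (Real.exp (-H) * H ^ 2) * (1 / θ)) := by ring
    _ ≤ _ := by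
        gcongr
        · exact exp_neg_mul_self_le
        · exact exp_neg_mul_sq_le h0

lemma weight_expWeight_add_ge (hθ : 0 ≤ θ) (p a : ℝ) (η : Config d) :
    weight (expWeight θ q p) U η + a * expWeightDeriv θ q p U η ≤
      weight (expWeight θ q (p + a)) U η := by
  rw [expWeightDeriv, ← weight_const_mul, weight, weight, ← Finset.sum_add_distrib]
  refine Finset.sum_le_sum fun x _ => ?_
  rw [← add_mul]
  refine mul_le_mul_of_nonneg_right ?_ (Nat.cast_nonneg _)
  have h1 := mul_le_mul_of_nonneg_left (Real.add_one_le_exp (a * q x))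
    (expWeight_nonneg (q := q) hθ p x)
  have h2 : expWeight θ q (p + a) x = expWeight θ q p x * Real.exp (a * q x) := by
    rw [expWeight, expWeight, add_mul, Real.exp_add]; ring
  rw [h2]
  linarith

lemma exp_neg_weight_add_le (hθ : 0 ≤ θ) (hq : ∀ x, 0 ≤ q x) (p : ℝ) {a : ℝ} (ha : 0 ≤ a)
    (η : Config d) :
    Real.exp (-weight (expWeight θ q (p + a)) U η) ≤
      Real.exp (-weight (expWeight θ q p) U η)
      - a * (Real.exp (-weight (expWeight θ q p) U η) * expWeightDeriv θ q p U η)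
      + 2 * (∑ x ∈ U, q x) ^ 2 * a ^ 2 := by
  have h0 := weight_nonneg (U := U) (expWeight_nonneg (q := q) hθ p) η
  have hD := expWeightDeriv_le (U := U) hθ hq p η
  have hD0 := expWeightDeriv_nonneg (U := U) hθ hq p η
  have hadd := weight_expWeight_add_ge (U := U) (q := q) hθ p a η
  have hQ : 0 ≤ ∑ x ∈ U, q x := Finset.sum_nonneg fun x _ => hq x
  set H := weight (expWeight θ q p) U η
  set D := expWeightDeriv θ q p U η
  have hsq : Real.exp (-H) * D ^ 2 ≤ 2 * (∑ x ∈ U, q x) ^ 2 :=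
    calc Real.exp (-H) * D ^ 2 ≤ Real.exp (-H) * ((∑ x ∈ U, q x) * H) ^ 2 := by gcongr
      _ = (∑ x ∈ U, q x) ^ 2 * (Real.exp (-H) * H ^ 2) := by ring
      _ ≤ (∑ x ∈ U, q x) ^ 2 * 2 := by gcongr; exact exp_neg_mul_sq_le h0
      _ = _ := by ring
  calc _ ≤ Real.exp (-H + -(a * D)) := Real.exp_le_exp.2 (by linarith)
    _ = Real.exp (-H) * Real.exp (-(a * D)) := Real.exp_add _ _
    _ ≤ Real.exp (-H) * (1 - a * D + (a * D) ^ 2) := by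
        gcongr; exact exp_neg_le_quadratic (mul_nonneg ha hD0)
    _ = Real.exp (-H) - a * (Real.exp (-H) * D) + (Real.exp (-H) * D ^ 2) * a ^ 2 := by ring
    _ ≤ _ := by gcongr

lemma IsGrowthRate.neg_le_generator {T : ℝ} (hq : IsGrowthRate κ w T q) (hθ : 0 ≤ θ) {s : ℝ}
    (hs : 0 ≤ s) (hsT : s ≤ T) (η : Config d) :
    -(Real.exp (-weight (expWeight θ q s) U η) * expWeightDeriv θ q s U η) ≤
      generator κ w U (fun ζ => Real.exp (-weight (expWeight θ q s) U ζ)) η := by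
  refine neg_le_generator_exp_neg_weight (expWeight_nonneg hθ s) (fun x _ => ?_) η
  have := mul_le_mul_of_nonneg_left (hq.supersolution x s hs hsT) hθ
  simp only [expWeight, ← Finset.mul_sum]
  linarith

variable {ν : Measure (Config d)} {Ω : Type*} [MeasurableSpace Ω] {P : Measure Ω}
  [IsProbabilityMeasure P] {X : ℝ≥0 → Ω → Config d}

/-- The Laplace functional `E[exp(-H_{T-t}(X_t)); A]` with `H_s = ∑ θ e^{s q(x)} η(x)` decreases
on `[s, r]` by at most a constant times `(r - s)²`: the drift of `H` is compensated to first order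
by the decrease of the weights. -/
lemma IsProcessOn.laplace_step (hX : IsProcessOn κ w U ν P X) {T : ℝ≥0}
    (hq : IsGrowthRate κ w T q) (hθ : 0 < θ) {s r : ℝ≥0} (hsr : s ≤ r) (hrT : r ≤ T)
    {A : Set Ω} (hA : MeasurableSet[history X hX.measurable s] A) :
    ∫ ω in A, Real.exp (-weight (expWeight θ q (T - s)) U (X s ω)) ∂P
      - ∫ ω in A, Real.exp (-weight (expWeight θ q (T - r)) U (X r ω)) ∂P ≤
      (2 * (∑ x ∈ U, q x) ^ 2 +
        2 * ((∑ x ∈ U, q x) * (1 + 2 * (1 / θ))) * rateBound κ w U) * ((r : ℝ) - s) ^ 2 := by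
  have hq0 := hq.nonneg
  have hsr' : (s : ℝ) ≤ r := hsr
  have hrT' : (r : ℝ) ≤ T := hrT
  set p : ℝ := T - r with hp
  set a : ℝ := r - s with ha
  have hp0 : 0 ≤ p := by rw [hp]; linarith
  have hpT : p ≤ T := by rw [hp]; linarith [r.2]
  have ha0 : 0 ≤ a := by rw [ha]; linarith
  have hTs : (T : ℝ) - s = p + a := by rw [hp, ha]; ring
  set Q : ℝ := ∑ x ∈ U, q x with hQ
  set K : ℝ := Q * (1 + 2 * (1 / θ)) with hK
  set R : ℝ := rateBound κ w U with hR
  let g : Config d → ℝ := fun η => Real.exp (-weight (expWeight θ q p) U η)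
  let ψ : Config d → ℝ := fun η => g η * expWeightDeriv θ q p U η
  have hg : IsLocalOn U g := fun η η' h => by simp only [g, isLocalOn_weight _ h]
  have hψ : IsLocalOn U ψ := fun η η' h => by
    simp only [ψ, hg h, expWeightDeriv, isLocalOn_weight _ h]
  have hgd : g ∈ domain κ w U := mem_domain_of_decay hg (exp_neg_weight_decay hθ hq0 hp0)
  have hψK : ∀ η, |ψ η| * (1 + weight 1 U η) ≤ K := exp_neg_weight_mul_deriv_decay hθ hq0 hp0
  have hψd : ψ ∈ domain κ w U := mem_domain_of_decay hψ hψK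
  have hψL : ∀ η, |generator κ w U ψ η| ≤ 2 * K * R := abs_generator_le hψ hψK
  obtain ⟨Cg, hCg⟩ := hgd
  obtain ⟨Cψ, hCψ⟩ := hψd
  have hgi : ∀ t, Integrable (fun ω => g (X t ω)) (P.restrict A) := fun t =>
    (hX.integrable (fun η hη => (hCg η hη).1) t).restrict
  have hψi : ∀ t, Integrable (fun ω => ψ (X t ω)) (P.restrict A) := fun t =>
    (hX.integrable (fun η hη => (hCψ η hη).1) t).restrict
  have hLg := isLocalOn_generator (κ := κ) (w := w) hg
  have hLgi : ∀ t, Integrable (fun ω => generator κ w U g (X t ω)) (P.restrict A) := fun t =>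
    (hX.integrable (fun η hη => (hCg η hη).2) t).restrict
  -- the change of the weights at time `s`
  have e1 : ∫ ω in A, Real.exp (-weight (expWeight θ q (p + a)) U (X s ω)) ∂P ≤
      ∫ ω in A, g (X s ω) ∂P - a * ∫ ω in A, ψ (X s ω) ∂P + 2 * Q ^ 2 * a ^ 2 := by
    have hsub : Integrable (fun ω => g (X s ω) - a * ψ (X s ω)) (P.restrict A) :=
      (hgi s).sub ((hψi s).const_mul a)
    have hle : ∫ ω in A, Real.exp (-weight (expWeight θ q (p + a)) U (X s ω)) ∂P ≤
        ∫ ω in A, (g (X s ω) - a * ψ (X s ω) + 2 * Q ^ 2 * a ^ 2) ∂P := by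
      refine integral_mono_of_nonneg (Eventually.of_forall fun ω => (Real.exp_pos _).le)
        (hsub.add (integrable_const _))
        (Eventually.of_forall fun ω => exp_neg_weight_add_le hθ.le hq0 p ha0 _)
    refine hle.trans ?_
    rw [integral_add hsub (integrable_const _),
      integral_sub (hgi s) ((hψi s).const_mul a), integral_const_mul, integral_const]
    have : (P.restrict A).real Set.univ ≤ 1 := by
      rw [measureReal_restrict_apply_univ]; exact measureReal_le_one
    have h0 : 0 ≤ 2 * Q ^ 2 * a ^ 2 := by positivity
    have := mul_le_mul_of_nonneg_right this h0
    rw [smul_eq_mul]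
    linarith
  -- the evolution of the process between `s` and `r`
  have e2 := hX.dynkin hg ⟨Cg, hCg⟩ hsr hA
  have e3 : ∀ u : ℝ, (s : ℝ) ≤ u → u ≤ r →
      ∫ ω in A, ψ (X u.toNNReal ω) ∂P ≤ ∫ ω in A, ψ (X s ω) ∂P + 2 * K * R * a := by
    intro u hu hur
    have hsu : s ≤ u.toNNReal := by
      rw [← NNReal.coe_le_coe, Real.coe_toNNReal u (s.2.trans hu)]; exact hu
    have h1 := hX.dynkin hψ ⟨Cψ, hCψ⟩ hsu hA
    rw [Real.coe_toNNReal u (s.2.trans hu)] at h1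
    have h2 : ‖∫ v in (s : ℝ)..u, (∫ ω in A, generator κ w U ψ (X v.toNNReal ω) ∂P)‖ ≤
        2 * K * R * |u - s| := by
      refine intervalIntegral.norm_integral_le_of_norm_le_const fun v _ => ?_
      have h3 := norm_setIntegral_le_of_norm_le_const (μ := P) (s := A)
        (f := fun ω => generator κ w U ψ (X v.toNNReal ω)) (measure_lt_top P A)
        (fun ω _ => hψL (X v.toNNReal ω))
      refine h3.trans (mul_le_of_le_one_right ?_ measureReal_le_one)
      exact (abs_nonneg _).trans (hψL 0)
    have h4 := (le_abs_self _).trans h2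
    rw [abs_of_nonneg (by linarith : (0 : ℝ) ≤ u - s)] at h4
    have h5 : 2 * K * R * (u - s) ≤ 2 * K * R * a :=
      mul_le_mul_of_nonneg_left (by rw [ha]; linarith) ((abs_nonneg _).trans (hψL 0))
    linarith
  have e4 : -(a * (∫ ω in A, ψ (X s ω) ∂P + 2 * K * R * a)) ≤
      ∫ u in (s : ℝ)..r, (∫ ω in A, generator κ w U g (X u.toNNReal ω) ∂P) := by
    have hii : IntervalIntegrable
        (fun u : ℝ => ∫ ω in A, generator κ w U g (X u.toNNReal ω) ∂P) volume s r := by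
      rw [intervalIntegrable_iff]
      exact (hX.integrable_prod hLg (fun η hη => (hCg η hη).2) A s r).integral_prod_left
    have h1 := intervalIntegral.integral_mono_on (μ := volume) hsr'
      (intervalIntegrable_const (c := -(∫ ω in A, ψ (X s ω) ∂P + 2 * K * R * a))) hii
      (fun u hu => ?_)
    · rw [intervalIntegral.integral_const, smul_eq_mul] at h1
      linarith
    · refine (neg_le_neg (e3 u hu.1 hu.2)).trans ?_
      rw [← integral_neg]
      exact integral_mono (hψi _).neg (hLgi _) fun ω =>
        hq.neg_le_generator hθ.le hp0 hpT (X u.toNNReal ω)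
  rw [hTs]
  change _ - ∫ ω in A, g (X r ω) ∂P ≤ _
  nlinarith [e1, e2, e4]

/-- `t ↦ E[exp(-H_{T-t}(X_t)); A]` is nondecreasing. -/
lemma IsProcessOn.laplace_mono (hX : IsProcessOn κ w U ν P X) {T : ℝ≥0}
    (hq : IsGrowthRate κ w T q) (hθ : 0 < θ) {s t : ℝ≥0} (hst : s ≤ t) (htT : t ≤ T)
    {A : Set Ω} (hA : MeasurableSet[history X hX.measurable s] A) :
    ∫ ω in A, Real.exp (-weight (expWeight θ q (T - s)) U (X s ω)) ∂P ≤
      ∫ ω in A, Real.exp (-weight (expWeight θ q (T - t)) U (X t ω)) ∂P := by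
  have h := le_of_sub_le_sq (F := fun u : ℝ =>
    ∫ ω in A, Real.exp (-weight (expWeight θ q (T - u.toNNReal)) U (X u.toNNReal ω)) ∂P)
    (a := s) (b := t) (NNReal.coe_le_coe.2 hst) (fun u v hu huv hv => by
      have hu0 : 0 ≤ u := s.2.trans hu
      have hsu : s ≤ u.toNNReal := by
        rw [← NNReal.coe_le_coe, Real.coe_toNNReal u hu0]; exact hu
      have hvT : v.toNNReal ≤ T := (Real.toNNReal_le_iff_le_coe.2 hv).trans htT
      have := hX.laplace_step hq hθ (Real.toNNReal_le_toNNReal huv) hvT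
        ((history X hX.measurable).mono hsu _ hA)
      nth_rewrite 2 [Real.coe_toNNReal u hu0] at this
      nth_rewrite 2 [Real.coe_toNNReal v (hu0.trans huv)] at this
      exact this)
  simpa using h

/-- The process `∑_{x ∈ U} e^{(T-t) q(x)} X_t(x)`, `t ≤ T`, is a supermartingale (with values in
`[0, ∞]`): let `θ → 0` in the monotonicity of the Laplace functional. -/
theorem IsProcessOn.supermartingale (hX : IsProcessOn κ w U ν P X) {T : ℝ≥0}
    (hq : IsGrowthRate κ w T q) {s t : ℝ≥0} (hst : s ≤ t) (htT : t ≤ T)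
    {A : Set Ω} (hA : MeasurableSet[history X hX.measurable s] A) :
    ∫⁻ ω in A, ENNReal.ofReal (weight (expWeight 1 q (T - t)) U (X t ω)) ∂P ≤
      ∫⁻ ω in A, ENNReal.ofReal (weight (expWeight 1 q (T - s)) U (X s ω)) ∂P := by
  let θ : ℕ → ℝ := fun k => 1 / ((k : ℝ) + 1)
  have hθ0 : ∀ k, 0 < θ k := fun k => by positivity
  have hθlim : Tendsto θ atTop (𝓝 0) := tendsto_one_div_add_atTop_nhds_zero_nat
  let H : ℝ≥0 → Ω → ℝ := fun r ω => weight (expWeight 1 q (T - r)) U (X r ω)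
  have hH0 : ∀ r ω, 0 ≤ H r ω := fun r ω => weight_nonneg (expWeight_nonneg zero_le_one _) _
  have hHm : ∀ r, Measurable (H r) := fun r => 
    (measurable_from_top (f := weight (expWeight 1 q (T - r)) U)).comp (hX.measurable r)
  let G : ℕ → ℝ≥0 → Ω → ℝ := fun k r ω => (1 - Real.exp (-(θ k * H r ω))) / θ k
  have hexp : ∀ k r ω, Real.exp (-(θ k * H r ω)) ≤ 1 := fun k r ω =>
    Real.exp_le_one_iff.2 (neg_nonpos.2 (mul_nonneg (hθ0 k).le (hH0 r ω)))
  have hG0 : ∀ k r ω, 0 ≤ G k r ω := fun k r ω =>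
    div_nonneg (sub_nonneg.2 (hexp k r ω)) (hθ0 k).le
  have hem : ∀ k r, Measurable fun ω => Real.exp (-(θ k * H r ω)) := fun k r =>
    Real.measurable_exp.comp ((hHm r).const_mul _).neg
  have hGm : ∀ k r, Measurable (G k r) := fun k r => ((hem k r).const_sub 1).div_const _
  have hei : ∀ k r, Integrable (fun ω => Real.exp (-(θ k * H r ω))) (P.restrict A) := fun k r =>
    Integrable.of_bound (C := 1) (hem k r).aestronglyMeasurable
      (Eventually.of_forall fun ω => by
        rw [Real.norm_eq_abs, abs_of_pos (Real.exp_pos _)]; exact hexp k r ω)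
  have hGle : ∀ k r ω, G k r ω ≤ H r ω := fun k r ω => by
    rw [div_le_iff₀ (hθ0 k)]
    linarith [Real.add_one_le_exp (-(θ k * H r ω))]
  have hGge : ∀ k r ω, H r ω - θ k * H r ω ^ 2 ≤ G k r ω := fun k r ω => by
    rw [le_div_iff₀ (hθ0 k)]
    nlinarith [exp_neg_le_quadratic (mul_nonneg (hθ0 k).le (hH0 r ω))]
  have hGlim : ∀ r ω, Tendsto (fun k => G k r ω) atTop (𝓝 (H r ω)) := fun r ω => by
    refine tendsto_of_tendsto_of_tendsto_of_le_of_le ?_ tendsto_const_nhds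
      (fun k => hGge k r ω) (fun k => hGle k r ω)
    simpa using tendsto_const_nhds.sub (hθlim.mul_const (H r ω ^ 2))
  have hGint : ∀ k r, ∫⁻ ω in A, ENNReal.ofReal (G k r ω) ∂P =
      ENNReal.ofReal ((P.real A - ∫ ω in A, Real.exp (-(θ k * H r ω)) ∂P) / θ k) := fun k r => by
    have hi : Integrable (G k r) (P.restrict A) :=
      ((integrable_const _).sub (hei k r)).div_const _
    rw [← ofReal_integral_eq_lintegral_ofReal hi (Eventually.of_forall (hG0 k r)),
      integral_div, integral_sub (integrable_const _) (hei k r)]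
    simp
  have hmono : ∀ k, ∫⁻ ω in A, ENNReal.ofReal (G k t ω) ∂P ≤
      ∫⁻ ω in A, ENNReal.ofReal (H s ω) ∂P := fun k => by
    refine le_trans ?_ (lintegral_mono fun ω => ENNReal.ofReal_le_ofReal (hGle k s ω))
    rw [hGint, hGint]
    refine ENNReal.ofReal_le_ofReal (div_le_div_of_nonneg_right (sub_le_sub_left ?_ _) (hθ0 k).le)
    have := hX.laplace_mono hq (hθ0 k) hst htT hA
    simpa only [weight_expWeight (θ := θ k)] using this
  calc ∫⁻ ω in A, ENNReal.ofReal (H t ω) ∂P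
      = ∫⁻ ω in A, liminf (fun k => ENNReal.ofReal (G k t ω)) atTop ∂P := by
        refine lintegral_congr fun ω => ?_
        exact ((ENNReal.continuous_ofReal.tendsto _).comp (hGlim t ω)).liminf_eq.symm
    _ ≤ liminf (fun k => ∫⁻ ω in A, ENNReal.ofReal (G k t ω) ∂P) atTop :=
        lintegral_liminf_le fun k => (hGm k t).ennreal_ofReal
    _ ≤ liminf (fun _ : ℕ => ∫⁻ ω in A, ENNReal.ofReal (H s ω) ∂P) atTop :=
        liminf_le_liminf (Eventually.of_forall hmono)
    _ = _ := liminf_const _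

end Supermartingale

/-! ### The maximal inequality -/

section Maximal

variable {d : ℕ} {κ : ℝ≥0} {w : Field d} {U : Finset (Site d)} {q : Site d → ℝ}
  {ν : Measure (Config d)} {Ω : Type*} [MeasurableSpace Ω] {P : Measure Ω}
  [IsProbabilityMeasure P] {X : ℝ≥0 → Ω → Config d}

lemma measurableSet_history (hX : ∀ t, Measurable (X t)) (t : ℝ≥0) (B : Set (Config d)) :
    MeasurableSet[history X hX t] (X t ⁻¹' B) :=
  le_iSup₂ (f := fun s (_ : s ≤ t) => MeasurableSpace.comap (X s) (instMeasurableSpaceConfig d))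
    t le_rfl _ ⟨B, trivial, rfl⟩

/-- Maximal inequality for the supermartingale along finitely many times. -/
lemma IsProcessOn.maximal_finset (hX : IsProcessOn κ w U ν P X) {T : ℝ≥0}
    (hq : IsGrowthRate κ w T q) (c : ℝ≥0∞) (S : Finset ℝ≥0) :
    ∀ (s : ℝ≥0) (A : Set Ω), MeasurableSet[history X hX.measurable s] A → s ≤ T →
      (∀ t ∈ S, s ≤ t ∧ t ≤ T) →
      c * P (A ∩ {ω | ∃ t ∈ S, c ≤ ENNReal.ofReal (weight (expWeight 1 q (T - t)) U (X t ω))}) ≤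
        ∫⁻ ω in A, ENNReal.ofReal (weight (expWeight 1 q (T - s)) U (X s ω)) ∂P := by
  set Y : ℝ≥0 → Ω → ℝ≥0∞ := fun t ω =>
    ENNReal.ofReal (weight (expWeight 1 q (T - t)) U (X t ω)) with hY
  change ∀ (s : ℝ≥0) (A : Set Ω), _ → _ → _ →
    c * P (A ∩ {ω | ∃ t ∈ S, c ≤ Y t ω}) ≤ ∫⁻ ω in A, Y s ω ∂P
  induction S using Finset.induction_on_min with
  | empty => intro s A _ _ _; simp
  | insert a S haS ih =>
    intro s A hA _ hS
    obtain ⟨hsa, haT⟩ := hS a (Finset.mem_insert_self a S)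
    have hAa := (history X hX.measurable).mono hsa _ hA
    -- split according to whether the level is reached at the first of the times
    have hB : MeasurableSet[history X hX.measurable a] {ω | c ≤ Y a ω} :=
      measurableSet_history hX.measurable a
        {η | c ≤ ENNReal.ofReal (weight (expWeight 1 q (T - a)) U η)}
    have hB' : MeasurableSet {ω | c ≤ Y a ω} := (history X hX.measurable).le a _ hB
    have h1 : c * P (A ∩ {ω | c ≤ Y a ω}) ≤ ∫⁻ ω in A ∩ {ω | c ≤ Y a ω}, Y a ω ∂P := by
      rw [← setLIntegral_const]
      exact setLIntegral_mono' (((history X hX.measurable).le a _ hAa).inter hB')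
        fun ω hω => hω.2
    have h2 := ih a (A \ {ω | c ≤ Y a ω}) (hAa.diff hB) haT fun t ht =>
      ⟨(haS t ht).le, (hS t (Finset.mem_insert_of_mem ht)).2⟩
    have hsub : A ∩ {ω | ∃ t ∈ insert a S, c ≤ Y t ω} ⊆ (A ∩ {ω | c ≤ Y a ω}) ∪
        ((A \ {ω | c ≤ Y a ω}) ∩ {ω | ∃ t ∈ S, c ≤ Y t ω}) := by
      rintro ω ⟨hωA, t, ht, hc⟩
      by_cases hωa : c ≤ Y a ω
      · exact Or.inl ⟨hωA, hωa⟩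
      · rcases Finset.mem_insert.1 ht with rfl | ht
        · exact absurd hc hωa
        · exact Or.inr ⟨⟨hωA, hωa⟩, t, ht, hc⟩
    calc c * P (A ∩ {ω | ∃ t ∈ insert a S, c ≤ Y t ω})
        ≤ c * (P (A ∩ {ω | c ≤ Y a ω}) +
            P ((A \ {ω | c ≤ Y a ω}) ∩ {ω | ∃ t ∈ S, c ≤ Y t ω})) := by
          gcongr; exact (measure_mono hsub).trans (measure_union_le _ _)
      _ ≤ ∫⁻ ω in A ∩ {ω | c ≤ Y a ω}, Y a ω ∂P + ∫⁻ ω in A \ {ω | c ≤ Y a ω}, Y a ω ∂P := by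
          rw [mul_add]; exact add_le_add h1 h2
      _ = ∫⁻ ω in A, Y a ω ∂P := lintegral_inter_add_sdiff _ _ hB'
      _ ≤ ∫⁻ ω in A, Y s ω ∂P := hX.supermartingale hq hsa haT hA

/-- Maximal inequality for the supermartingale along a sequence of times. -/
lemma IsProcessOn.maximal_seq (hX : IsProcessOn κ w U ν P X) {T : ℝ≥0}
    (hq : IsGrowthRate κ w T q) (c : ℝ≥0∞) (τ : ℕ → ℝ≥0) (hτ : ∀ k, τ k ≤ T)
    {A : Set Ω} (hA : MeasurableSet[history X hX.measurable 0] A) :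
    c * P (A ∩ {ω | ∃ k, c ≤ ENNReal.ofReal
        (weight (expWeight 1 q (T - τ k)) U (X (τ k) ω))}) ≤
      ∫⁻ ω in A, ENNReal.ofReal (weight (expWeight 1 q T) U (X 0 ω)) ∂P := by
  set Y : ℝ≥0 → Ω → ℝ≥0∞ := fun t ω =>
    ENNReal.ofReal (weight (expWeight 1 q (T - t)) U (X t ω)) with hY
  have hU : A ∩ {ω | ∃ k, c ≤ Y (τ k) ω} =
      ⋃ N : ℕ, A ∩ {ω | ∃ t ∈ (Finset.range N).image τ, c ≤ Y t ω} := by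
    ext ω
    simp only [Set.mem_inter_iff, Set.mem_ofPred_eq, Set.mem_iUnion, Finset.mem_image,
      Finset.mem_range]
    constructor
    · rintro ⟨h1, k, hk⟩
      exact ⟨k + 1, h1, τ k, ⟨k, Nat.lt_succ_self k, rfl⟩, hk⟩
    · rintro ⟨N, h1, _, ⟨k, _, rfl⟩, hk⟩
      exact ⟨h1, k, hk⟩
  have hmono : Monotone fun N : ℕ =>
      A ∩ {ω | ∃ t ∈ (Finset.range N).image τ, c ≤ Y t ω} := by
    rintro M N hMN ω ⟨h1, t, ht, hc⟩
    exact ⟨h1, t, Finset.image_subset_image (Finset.range_subset_range.2 hMN) ht, hc⟩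
  change c * P (A ∩ {ω | ∃ k, c ≤ Y (τ k) ω}) ≤ _
  rw [hU, hmono.measure_iUnion, ENNReal.mul_iSup]
  refine iSup_le fun N => ?_
  have := hX.maximal_finset hq c ((Finset.range N).image τ) 0 A hA (zero_le) fun t ht => by
    obtain ⟨k, _, rfl⟩ := Finset.mem_image.1 ht
    exact ⟨zero_le, hτ k⟩
  simpa using this

end Maximal

/-! ### Existence of a growth rate -/

section GrowthRate

variable {d : ℕ}

lemma euclNorm_eq_norm (x : Site d) :
    euclNorm x = ‖(WithLp.toLp 2 fun i => (x i : ℝ) : EuclideanSpace ℝ (Fin d))‖ := by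
  simp [euclNorm, EuclideanSpace.norm_eq]

lemma euclNorm_nonneg (x : Site d) : 0 ≤ euclNorm x := Real.sqrt_nonneg _

lemma euclNorm_le_add_one {x y : Site d} (hy : y ∈ neighbors x) :
    euclNorm y ≤ euclNorm x + 1 := by
  have h1 : euclNorm (y - x) = 1 := by
    have h : ∑ i, (y i - x i) ^ 2 = 1 := (Finset.mem_filter.1 hy).2
    have h' : ∑ i, (((y - x) i : ℤ) : ℝ) ^ 2 = 1 := by
      simp only [Pi.sub_apply]; exact_mod_cast h
    rw [euclNorm, h', Real.sqrt_one]
  rw [← h1]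
  simp only [euclNorm_eq_norm]
  refine le_trans (le_of_eq ?_) (norm_add_le _ _)
  congr 1
  ext i
  simp

lemma card_neighbors_le (x : Site d) : (neighbors x).card ≤ 3 ^ d := by
  refine (Finset.card_filter_le _ _).trans ?_
  rw [Pi.card_Icc]
  refine (Finset.prod_le_pow_card _ _ 3 fun i _ => ?_).trans (by simp)
  rw [Int.card_Icc]
  simp only [Pi.add_apply, Pi.sub_apply, Pi.one_apply]
  omega

lemma mem_box_of_euclNorm_le {x : Site d} {n : ℕ} (h : euclNorm x ≤ n) : x ∈ box d n := by
  have hi : ∀ i, |x i| ≤ (n : ℤ) := fun i => by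
    have h1 : |(x i : ℝ)| ≤ euclNorm x := by
      rw [← Real.sqrt_sq_eq_abs]
      exact Real.sqrt_le_sqrt (Finset.single_le_sum (f := fun i => (x i : ℝ) ^ 2)
        (fun j _ => sq_nonneg _) (Finset.mem_univ i))
    exact_mod_cast h1.trans h
  exact Finset.mem_Icc.2 ⟨fun i => (abs_le.1 (hi i)).1, fun i => (abs_le.1 (hi i)).2⟩

/-- The growth assumption in the form `v_+(x) ≤ ε (|x| + 2) log (|x| + 2) + K` for all `x`. -/
lemma exists_vPlus_le {w : Field d}
    (hw : limsup (fun x : Site d =>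
        (((w.vPlus x : ℝ) / (euclNorm x * Real.log (euclNorm x)) : ℝ) : EReal))
      (comap euclNorm atTop) = 0) {ε : ℝ} (hε : 0 < ε) :
    ∃ K, 0 ≤ K ∧ ∀ x, (w.vPlus x : ℝ) ≤
      ε * ((euclNorm x + 2) * Real.log (euclNorm x + 2)) + K := by
  have hev := eventually_lt_of_limsup_lt (hw.trans_lt (EReal.coe_pos.2 hε))
  rw [eventually_comap] at hev
  obtain ⟨R, hR⟩ := eventually_atTop.1 hev
  obtain ⟨n, hn⟩ := exists_nat_ge (max R 2)
  refine ⟨∑ x ∈ box d n, (w.vPlus x : ℝ), Finset.sum_nonneg fun x _ => (w.vPlus x).2,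
    fun x => ?_⟩
  have hr := euclNorm_nonneg x
  have hφ : 0 ≤ (euclNorm x + 2) * Real.log (euclNorm x + 2) :=
    mul_nonneg (by linarith) (Real.log_nonneg (by linarith))
  by_cases hx : euclNorm x ≤ n
  · have := Finset.single_le_sum (f := fun x => (w.vPlus x : ℝ)) (fun y _ => (w.vPlus y).2)
      (mem_box_of_euclNorm_le hx)
    have := mul_nonneg hε.le hφ
    linarith
  · have hx' : max R 2 < euclNorm x := hn.trans_lt (not_le.1 hx)
    have h2 : 2 < euclNorm x := (le_max_right _ _).trans_lt hx'
    have h := EReal.coe_lt_coe_iff.1 (hR _ ((le_max_left _ _).trans hx'.le) x rfl)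
    have hlog : 0 < Real.log (euclNorm x) := Real.log_pos (by linarith)
    rw [div_lt_iff₀ (mul_pos (by linarith) hlog)] at h
    have h3 : euclNorm x * Real.log (euclNorm x) ≤
        (euclNorm x + 2) * Real.log (euclNorm x + 2) := by
      gcongr <;> linarith
    have h4 := mul_le_mul_of_nonneg_left h3 hε.le
    have h5 : 0 ≤ ∑ x ∈ box d n, (w.vPlus x : ℝ) := Finset.sum_nonneg fun x _ => (w.vPlus x).2
    linarith

lemma mul_log_add_one_le {u : ℝ} (hu : 0 < u) :
    (u + 1) * Real.log (u + 1) ≤ u * Real.log u + (1 + Real.log (u + 1)) := by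
  have h1 : Real.log (u + 1) = Real.log u + Real.log ((u + 1) / u) := by
    rw [Real.log_div (by positivity) hu.ne']; ring
  have h2 : Real.log ((u + 1) / u) ≤ 1 / u := by
    refine (Real.log_le_sub_one_of_pos (by positivity)).trans (le_of_eq ?_)
    field_simp; ring
  have h3 : u * Real.log ((u + 1) / u) ≤ 1 := by
    calc _ ≤ u * (1 / u) := mul_le_mul_of_nonneg_left h2 hu.le
      _ = 1 := by field_simp
  nlinarith

/-- A square root is dominated by any small multiple of `u log u`, up to a constant. -/
lemma mul_exp_half_log_le {C ε u : ℝ} (hε : 0 < ε) (hu : 2 ≤ u) :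
    C * Real.exp ((1 + Real.log (u + 1)) / 2) ≤ ε * (u * Real.log u) + 5 * C ^ 2 / ε := by
  set z := Real.exp ((1 + Real.log (u + 1)) / 2) with hz
  have hz2 : z ^ 2 ≤ 3 * (u + 1) := by
    have : z ^ 2 = Real.exp 1 * (u + 1) := by
      rw [hz, ← Real.exp_nat_mul, ← Real.exp_log (show 0 < u + 1 by linarith), ← Real.exp_add,
        Real.exp_log (show 0 < u + 1 by linarith)]
      congr 1; push_cast; ring
    rw [this]
    exact mul_le_mul_of_nonneg_right Real.exp_one_lt_three.le (by linarith)
  have hlog : 1 / 2 ≤ Real.log u :=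
    (by linarith [Real.log_two_gt_d9] : (1 : ℝ) / 2 ≤ Real.log 2).trans
      (Real.log_le_log two_pos hu)
  have h1 : ε * (z ^ 2 / 10) ≤ ε * (u * Real.log u) := by
    refine mul_le_mul_of_nonneg_left ?_ hε.le
    nlinarith
  have h2 : C * z ≤ ε * (z ^ 2 / 10) + 5 * C ^ 2 / ε := by
    have : ε * (z ^ 2 / 10) + 5 * C ^ 2 / ε - C * z =
        ((ε * z - 5 * C) ^ 2 + 25 * C ^ 2) / (10 * ε) := by field_simp; ring
    have h3 : 0 ≤ ((ε * z - 5 * C) ^ 2 + 25 * C ^ 2) / (10 * ε) := by positivity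
    linarith
  linarith

/-- The growth assumption gives, for each time horizon `T`, a growth rate of the form
`q(x) = K + 2 ε (|x| + 2) log (|x| + 2)`. For `ε` small in terms of `T`, going to a neighbour
raises `e^{s q}` by a factor of order at most `√|x|`, which `q` dominates. -/
theorem exists_isGrowthRate (κ : ℝ≥0) {w : Field d}
    (hw : limsup (fun x : Site d =>
        (((w.vPlus x : ℝ) / (euclNorm x * Real.log (euclNorm x)) : ℝ) : EReal))
      (comap euclNorm atTop) = 0) (T : ℝ≥0) :
    ∃ q : Site d → ℝ, IsGrowthRate κ w T q := by
  have hT : (0 : ℝ) ≤ T := T.2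
  set ε : ℝ := 1 / (4 * (T + 1)) with hεd
  have hε : 0 < ε := by positivity
  have hεT : 2 * ε * T ≤ 1 / 2 := by
    rw [hεd, mul_one_div, div_mul_eq_mul_div, div_le_iff₀ (by positivity)]; linarith
  obtain ⟨K, hK0, hK⟩ := exists_vPlus_le hw hε
  set φ : ℝ → ℝ := fun u => u * Real.log u with hφ
  set C : ℝ := κ * 3 ^ d with hC
  have hφ0 : ∀ x : Site d, 0 ≤ φ (euclNorm x + 2) := fun x =>
    mul_nonneg (by linarith [euclNorm_nonneg x])
      (Real.log_nonneg (by linarith [euclNorm_nonneg x]))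
  have hCε : 0 ≤ 5 * C ^ 2 / ε := by positivity
  refine ⟨fun x => (K + 5 * C ^ 2 / ε) + 2 * ε * φ (euclNorm x + 2), fun x => ?_, ?_⟩
  · have := mul_nonneg (by positivity : 0 ≤ 2 * ε) (hφ0 x)
    linarith
  intro x s hs hsT
  set q : Site d → ℝ := fun x => (K + 5 * C ^ 2 / ε) + 2 * ε * φ (euclNorm x + 2) with hq
  set u := euclNorm x + 2 with hu
  have hu2 : 2 ≤ u := by linarith [euclNorm_nonneg x]
  have hlog0 : 0 ≤ 1 + Real.log (u + 1) := by
    linarith [Real.log_nonneg (show 1 ≤ u + 1 by linarith)]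
  have hstep : ∀ y ∈ neighbors x,
      Real.exp (s * q y) ≤ Real.exp (s * q x) * Real.exp ((1 + Real.log (u + 1)) / 2) := by
    intro y hy
    rw [← Real.exp_add, Real.exp_le_exp]
    have h1 : φ (euclNorm y + 2) ≤ φ (u + 1) := by
      have h0 := euclNorm_nonneg y
      have h2 : euclNorm y + 2 ≤ u + 1 := by linarith [euclNorm_le_add_one hy]
      exact mul_le_mul h2 (Real.log_le_log (by linarith) h2)
        (Real.log_nonneg (by linarith)) (by linarith)
    have h2 : φ (u + 1) ≤ φ u + (1 + Real.log (u + 1)) := mul_log_add_one_le (by linarith)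
    have h3 : q y - q x ≤ 2 * ε * (1 + Real.log (u + 1)) := by
      have := mul_le_mul_of_nonneg_left (h1.trans h2) (by positivity : 0 ≤ 2 * ε)
      simp only [hq]
      linarith
    have h4 := mul_le_mul_of_nonneg_left h3 hs
    have h5 : s * (2 * ε * (1 + Real.log (u + 1))) ≤ 1 / 2 * (1 + Real.log (u + 1)) := by
      rw [← mul_assoc]
      refine mul_le_mul_of_nonneg_right ?_ hlog0
      nlinarith
    linarith
  have hsum : κ * ∑ y ∈ neighbors x, Real.exp (s * q y) ≤
      Real.exp (s * q x) * (C * Real.exp ((1 + Real.log (u + 1)) / 2)) := by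
    have h1 := Finset.sum_le_card_nsmul _ _ _ hstep
    rw [nsmul_eq_mul] at h1
    have h2 : ((neighbors x).card : ℝ) ≤ 3 ^ d := by exact_mod_cast card_neighbors_le x
    calc _ ≤ (κ : ℝ) * ((neighbors x).card *
          (Real.exp (s * q x) * Real.exp ((1 + Real.log (u + 1)) / 2))) := by gcongr
      _ ≤ (κ : ℝ) * (3 ^ d *
          (Real.exp (s * q x) * Real.exp ((1 + Real.log (u + 1)) / 2))) := by gcongr
      _ = _ := by rw [hC]; ring
  have h1 := mul_exp_half_log_le (C := C) hε hu2
  have hrate : C * Real.exp ((1 + Real.log (u + 1)) / 2) + w.vPlus x ≤ q x := by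
    have := hK x
    simp only [hq]
    change _ ≤ ε * φ u + K at this
    change _ ≤ ε * φ u + _ at h1
    linarith
  have h2 := mul_le_mul_of_nonneg_left hrate (Real.exp_pos (s * q x)).le
  change κ * ∑ y ∈ neighbors x, Real.exp (s * q y) + w.vPlus x * Real.exp (s * q x) ≤
    q x * Real.exp (s * q x)
  linarith

end GrowthRate

/-! ### Monotone sequences of boxes -/

section Coupling

variable {d : ℕ}

lemma box_mono {m n : ℕ} (h : m ≤ n) : box d m ⊆ box d n :=
  Finset.Icc_subset_Icc (fun _ => by simpa using h) (fun _ => by simpa using h)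

lemma exists_subset_box (S : Finset (Site d)) : ∃ n, 1 ≤ n ∧ S ⊆ box d n := by
  obtain ⟨n, hn⟩ := exists_nat_ge (∑ x ∈ S, euclNorm x)
  refine ⟨n + 1, by omega, fun x hx => box_mono n.le_succ (mem_box_of_euclNorm_le ?_)⟩
  exact (Finset.single_le_sum (fun y _ => euclNorm_nonneg y) hx).trans hn

/-- The number of particles in `U`. -/
def particleNumber (U : Finset (Site d)) (ξ : Config d) : ℝ≥0∞ := ∑ x ∈ U, (ξ x : ℝ≥0∞)

lemma particleNumber_le_weight {h : Site d → ℝ} {U : Finset (Site d)} (hh : ∀ x, 1 ≤ h x)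
    (ξ : Config d) : particleNumber U ξ ≤ ENNReal.ofReal (weight h U ξ) := by
  rw [weight, ENNReal.ofReal_sum_of_nonneg fun x _ =>
    mul_nonneg (zero_le_one.trans (hh x)) (Nat.cast_nonneg _)]
  refine Finset.sum_le_sum fun x _ => ?_
  rw [← ENNReal.ofReal_natCast]
  exact ENNReal.ofReal_le_ofReal (le_mul_of_one_le_left (Nat.cast_nonneg _) (hh x))

lemma weight_le_weight_support {h : Site d → ℝ} (hh : ∀ x, 0 ≤ h x) (U : Finset (Site d))
    (ξ : Config d) : weight h U ξ ≤ weight h ξ.support ξ := by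
  have h0 : ∀ x, 0 ≤ h x * (ξ x : ℝ) := fun x => mul_nonneg (hh x) (Nat.cast_nonneg _)
  rw [weight, weight, ← Finset.sum_subset (Finset.inter_subset_left (s₁ := U) (s₂ := ξ.support))]
  · exact Finset.sum_le_sum_of_subset_of_nonneg Finset.inter_subset_right fun x _ _ => h0 x
  · intro x hx hx'
    have : ξ x = 0 := by
      simp only [Finset.mem_inter, Finsupp.mem_support_iff] at hx'
      tauto
    simp [this]

variable {Ω : Type*} {η : ℕ → ℝ≥0 → Ω → Config d}

/-- At the time `t` the sequence `n ↦ η n t ω x` is nondecreasing from the first box that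
contains `x` on. -/
def MonotoneAt (η : ℕ → ℝ≥0 → Ω → Config d) (t : ℝ≥0) (ω : Ω) : Prop :=
  ∀ n, 1 ≤ n → ∀ x ∈ box d n, η n t ω x ≤ η (n + 1) t ω x

lemma MonotoneAt.le {t : ℝ≥0} {ω : Ω} (h : MonotoneAt η t ω) {m n : ℕ} (hm : 1 ≤ m) (hmn : m ≤ n)
    {x : Site d} (hx : x ∈ box d m) : η m t ω x ≤ η n t ω x := by
  induction n, hmn using Nat.le_induction with
  | base => exact le_rfl
  | succ k hk ih => exact ih.trans (h k (hm.trans hk) x (box_mono hk hx))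

lemma MonotoneAt.particleNumber_mono {t : ℝ≥0} {ω : Ω} (h : MonotoneAt η t ω) :
    Monotone fun n => particleNumber (box d (n + 1)) (η (n + 1) t ω) := by
  intro m n hmn
  calc ∑ x ∈ box d (m + 1), (η (m + 1) t ω x : ℝ≥0∞)
      ≤ ∑ x ∈ box d (m + 1), (η (n + 1) t ω x : ℝ≥0∞) :=
        Finset.sum_le_sum fun x hx => by
          exact_mod_cast h.le (by omega) (by omega : m + 1 ≤ n + 1) hx
    _ ≤ _ := Finset.sum_le_sum_of_subset (box_mono (by omega))

lemma limitProcess_le_iSup (t : ℝ≥0) (ω : Ω) (x : Site d) (n₀ : ℕ) :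
    limitProcess η t ω x ≤ ⨆ k, (η (n₀ + k) t ω x : ℕ∞) := by
  refine limsup_le_of_le ⟨0, fun _ _ => zero_le⟩ ?_
  filter_upwards [eventually_ge_atTop n₀] with n hn
  obtain ⟨k, rfl⟩ := Nat.exists_eq_add_of_le hn
  exact le_iSup (fun k => (η (n₀ + k) t ω x : ℕ∞)) k

lemma limitProcess_eq_of_eq {t : ℝ≥0} {ω : Ω}
    (h : ∀ n, 1 ≤ n → ∀ x ∈ box d n, η (n + 1) t ω x = η n t ω x) {n : ℕ} (hn : 1 ≤ n)
    {x : Site d} (hx : x ∈ box d n) : limitProcess η t ω x = η n t ω x := by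
  have hconst : ∀ m, n ≤ m → η m t ω x = η n t ω x := fun m hm => by
    induction m, hm using Nat.le_induction with
    | base => rfl
    | succ k hk ih => rw [h k (hn.trans hk) x (box_mono hk hx), ih]
  have : (fun m => (η m t ω x : ℕ∞)) =ᶠ[atTop] fun _ => (η n t ω x : ℕ∞) := by
    filter_upwards [eventually_ge_atTop n] with m hm
    rw [hconst m hm]
  rw [limitProcess, limsup_congr this, limsup_const]

lemma MonotoneAt.totalNumber_le {t : ℝ≥0} {ω : Ω} (h : MonotoneAt η t ω) :
    totalNumber η t ω ≤ ⨆ n, particleNumber (box d (n + 1)) (η (n + 1) t ω) := by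
  rw [totalNumber, ENNReal.tsum_eq_iSup_sum]
  refine iSup_le fun S => ?_
  obtain ⟨n₀, hn₀, hS⟩ := exists_subset_box S
  calc ∑ x ∈ S, (limitProcess η t ω x : ℝ≥0∞)
      ≤ ∑ x ∈ S, ⨆ k, (η (n₀ + k) t ω x : ℝ≥0∞) := by
        refine Finset.sum_le_sum fun x _ => ?_
        refine (ENat.toENNReal_mono (limitProcess_le_iSup t ω x n₀)).trans (le_of_eq ?_)
        rw [ENat.toENNReal_iSup]
        simp
    _ = ⨆ k, ∑ x ∈ S, (η (n₀ + k) t ω x : ℝ≥0∞) := by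
        rw [← Finset.sum_coe_sort S, ENNReal.finsetSum_iSup_of_monotone fun x : S =>
          monotone_nat_of_le_succ fun k => by
            exact_mod_cast h (n₀ + k) (by omega) x (box_mono (by omega) (hS x.2))]
        exact iSup_congr fun k => Finset.sum_coe_sort S fun x => (η (n₀ + k) t ω x : ℝ≥0∞)
    _ ≤ _ := by
        refine iSup_le fun k => le_iSup_of_le (n₀ + k - 1) ?_
        have e : n₀ + k - 1 + 1 = n₀ + k := by omega
        rw [e]
        exact Finset.sum_le_sum_of_subset (hS.trans (box_mono (by omega)))

variable [MeasurableSpace Ω] {κ : ℝ≥0} {w : Field d} {ν : Measure (Config d)} {Q : Measure Ω}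

lemma IsNaturalCoupling.ae_monotoneAt (hη : IsNaturalCoupling κ w ν Q η) (t : ℝ≥0) :
    ∀ᵐ ω ∂Q, MonotoneAt η t ω :=
  ae_all_iff.2 fun n => (Filter.eventually_imp_distrib_left).2 fun hn => hη.monotone n hn t

lemma IsNaturalCoupling.setLIntegral_totalNumber_le (hη : IsNaturalCoupling κ w ν Q η)
    (t : ℝ≥0) (A : Set Ω) :
    ∫⁻ ω in A, totalNumber η t ω ∂Q ≤
      ⨆ n, ∫⁻ ω in A, particleNumber (box d (n + 1)) (η (n + 1) t ω) ∂Q := by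
  have hm : ∀ᵐ ω ∂(Q.restrict A), MonotoneAt η t ω := ae_restrict_of_ae (hη.ae_monotoneAt t)
  rw [← lintegral_iSup_ae
    (f := fun n ω => particleNumber (box d (n + 1)) (η (n + 1) t ω))
    (fun n => (measurable_from_top (f := particleNumber (box d (n + 1)))).comp ((hη.isProcessOn (n + 1) (by omega)).measurable t))
    (fun n => hm.mono fun ω h => h.particleNumber_mono n.le_succ)]
  exact lintegral_mono_ae (hm.mono fun ω h => h.totalNumber_le)

/-- The initial configurations of the coupled processes agree on the smaller box: they are ordered
and have the same law. -/
lemma IsNaturalCoupling.ae_initial_eq [IsFiniteMeasure Q] (hη : IsNaturalCoupling κ w ν Q η) :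
    ∀ᵐ ω ∂Q, ∀ n, 1 ≤ n → ∀ x ∈ box d n, η (n + 1) 0 ω x = η n 0 ω x := by
  refine ae_all_iff.2 fun n => (Filter.eventually_imp_distrib_left).2 fun hn => ?_
  refine (eventually_all_finset _).2 fun x hx => ?_
  have hX := hη.isProcessOn n hn
  have hX' := hη.isProcessOn (n + 1) (by omega)
  have hk : ∀ k : ℕ, ∀ᵐ ω ∂Q, (k ≤ η n 0 ω x ↔ k ≤ η (n + 1) 0 ω x) := fun k => by
    have hB : MeasurableSet {ξ : Config d | k ≤ ξ x} := trivial
    have hle : {ω | k ≤ η n 0 ω x} ≤ᵐ[Q] {ω | k ≤ η (n + 1) 0 ω x} := by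
      filter_upwards [hη.monotone n hn 0] with ω hω h
      exact le_trans h (hω x hx)
    have hms : MeasurableSet {ω | k ≤ η n 0 ω x} := hX.measurable 0 hB
    have heq : Q {ω | k ≤ η (n + 1) 0 ω x} = Q {ω | k ≤ η n 0 ω x} := by
      have e1 := Measure.map_apply (μ := Q) (hX.measurable 0) hB
      have e2 := Measure.map_apply (μ := Q) (hX'.measurable 0) hB
      rw [hX.initial] at e1
      rw [hX'.initial] at e2
      exact e2.symm.trans e1
    have := ae_eq_of_ae_subset_of_measure_ge hle heq.le hms.nullMeasurableSet
      (measure_ne_top _ _)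
    filter_upwards [this] with ω hω
    exact iff_of_eq hω
  filter_upwards [ae_all_iff.2 hk] with ω hω
  exact le_antisymm ((hω _).2 le_rfl) ((hω _).1 le_rfl)

/-! ### Finiteness of the expected number of particles -/

/-- The expected number of particles, on an event of the past, is controlled by the initial
configuration, uniformly in the size of the box. -/
lemma IsNaturalCoupling.setLIntegral_particleNumber_le [IsProbabilityMeasure Q]
    (hη : IsNaturalCoupling κ w ν Q η) {q : Site d → ℝ} {t : ℝ≥0} (hq : IsGrowthRate κ w t q)
    {n : ℕ} (hn : 1 ≤ n) {A : Set Ω}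
    (hA : MeasurableSet[history (η n) (hη.isProcessOn n hn).measurable 0] A) :
    ∫⁻ ω in A, particleNumber (box d n) (η n t ω) ∂Q ≤
      ∫⁻ ω in A, ENNReal.ofReal (weight (expWeight 1 q t) (box d n) (η n 0 ω)) ∂Q := by
  have h := (hη.isProcessOn n hn).supermartingale hq (zero_le : 0 ≤ t) le_rfl hA
  simp only [NNReal.coe_zero, sub_zero, sub_self] at h
  exact (lintegral_mono fun ω => particleNumber_le_weight
    (fun x => le_expWeight zero_le_one le_rfl (hq.nonneg x)) _).trans h

/-- Given the initial configuration, the expected total number of particles is finite. -/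
theorem IsNaturalCoupling.lintegral_totalNumber_lt_top_of_initial [IsProbabilityMeasure Q]
    (hη : IsNaturalCoupling κ w ν Q η) {q : Site d → ℝ} {t : ℝ≥0} (hq : IsGrowthRate κ w t q)
    (ξ : Config d) :
    ∫⁻ ω in {ω | ∀ x, limitProcess η 0 ω x = (ξ x : ℕ∞)}, totalNumber η t ω ∂Q < ⊤ := by
  have hh : ∀ x, 0 ≤ expWeight 1 q t x := expWeight_nonneg zero_le_one _
  refine ((hη.setLIntegral_totalNumber_le t _).trans (iSup_le fun n => ?_)).trans_lt
    (ENNReal.ofReal_lt_top (r := weight (expWeight 1 q t) ξ.support ξ))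
  have hX := hη.isProcessOn (n + 1) (by omega)
  set A : Set Ω := {ω | ∀ x ∈ box d (n + 1), η (n + 1) 0 ω x = ξ x} with hAdef
  have hA : MeasurableSet[history _ hX.measurable 0] A :=
    measurableSet_history hX.measurable 0 {ζ | ∀ x ∈ box d (n + 1), ζ x = ξ x}
  have hsub : {ω | ∀ x, limitProcess η 0 ω x = (ξ x : ℕ∞)} ≤ᵐ[Q] A := by
    filter_upwards [hη.ae_initial_eq] with ω hω h x hx
    have h1 := limitProcess_eq_of_eq hω (by omega) hx
    exact_mod_cast h1.symm.trans (h x)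
  calc _ ≤ ∫⁻ ω in A, particleNumber (box d (n + 1)) (η (n + 1) t ω) ∂Q :=
        lintegral_mono_set' hsub
    _ ≤ ∫⁻ ω in A, ENNReal.ofReal
          (weight (expWeight 1 q t) (box d (n + 1)) (η (n + 1) 0 ω)) ∂Q :=
        hη.setLIntegral_particleNumber_le hq (by omega) hA
    _ ≤ ∫⁻ _ in A, ENNReal.ofReal (weight (expWeight 1 q t) ξ.support ξ) ∂Q := by
        refine setLIntegral_mono' ((history _ hX.measurable).le 0 _ hA) fun ω hω => ?_
        rw [isLocalOn_weight (expWeight 1 q t) hω]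
        exact ENNReal.ofReal_le_ofReal (weight_le_weight_support hh _ ξ)
    _ ≤ _ := by
        rw [setLIntegral_const]
        exact mul_le_of_le_one_right' prob_le_one

/-- For an initial law on a fixed box the weights are bounded there, so that a finite first moment
suffices. -/
theorem IsNaturalCoupling.lintegral_totalNumber_lt_top [IsProbabilityMeasure Q]
    (hη : IsNaturalCoupling κ w ν Q η) {q : Site d → ℝ} {t : ℝ≥0} (hq : IsGrowthRate κ w t q)
    {R : ℕ} (hR : ∀ᵐ ξ ∂ν, ∀ x ∉ box d R, ξ x = 0)
    (hν : ∫⁻ ξ, (ξ.sum fun _ k => (k : ℝ≥0∞)) ∂ν < ⊤) :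
    ∫⁻ ω, totalNumber η t ω ∂Q < ⊤ := by
  have hh : ∀ x, 0 ≤ expWeight 1 q t x := expWeight_nonneg zero_le_one _
  set M : ℝ := ∑ x ∈ box d R, expWeight 1 q t x with hM
  have hM0 : 0 ≤ M := Finset.sum_nonneg fun x _ => hh x
  have hbound := hη.setLIntegral_totalNumber_le t Set.univ
  rw [setLIntegral_univ] at hbound
  refine (hbound.trans (iSup_le fun n => ?_)).trans_lt
    (ENNReal.mul_lt_top (ENNReal.ofReal_lt_top (r := M)) hν)
  have hX := hη.isProcessOn (n + 1) (by omega)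
  refine (hη.setLIntegral_particleNumber_le hq (by omega) MeasurableSet.univ).trans ?_
  rw [setLIntegral_univ, ← lintegral_map (μ := Q)
    (f := fun ξ => ENNReal.ofReal (weight (expWeight 1 q t) (box d (n + 1)) ξ))
    measurable_from_top (hX.measurable 0), hX.initial, ← lintegral_const_mul _ measurable_from_top]
  refine lintegral_mono_ae (hR.mono fun ξ hξ => ?_)
  have hle : weight (expWeight 1 q t) (box d (n + 1)) ξ ≤ M * ∑ x ∈ ξ.support, (ξ x : ℝ) := by
    refine (weight_le_weight_support hh _ ξ).trans ?_
    rw [weight, Finset.mul_sum]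
    refine Finset.sum_le_sum fun x hx => mul_le_mul_of_nonneg_right ?_ (Nat.cast_nonneg _)
    refine Finset.single_le_sum (fun y _ => hh y) ?_
    by_contra hxR
    exact Finsupp.mem_support_iff.1 hx (hξ x hxR)
  refine (ENNReal.ofReal_le_ofReal hle).trans (le_of_eq ?_)
  rw [ENNReal.ofReal_mul hM0, ENNReal.ofReal_sum_of_nonneg fun x _ => Nat.cast_nonneg _]
  simp [Finsupp.sum]

/-! ### Absence of explosion -/

/-- An enumeration of a dense subset of `[0, T)`, with the point `T` adjoined. -/
def denseTimes (T : ℝ≥0) (k : ℕ) : ℝ≥0 := min (TopologicalSpace.denseSeq ℝ≥0 k) T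

lemma exists_denseTimes {T t : ℝ≥0} (ht : t < T) {p : ℝ≥0 → Prop} (hp : ∀ᶠ s in 𝓝[>] t, p s) :
    ∃ k, p (denseTimes T k) := by
  obtain ⟨u, hu, hsub⟩ := (mem_nhdsGT_iff_exists_Ioo_subset).1 hp
  have hu' : t < min u T := lt_min hu ht
  obtain ⟨k, hk⟩ := (TopologicalSpace.denseRange_denseSeq ℝ≥0).exists_mem_open
    (isOpen_Ioo (a := t) (b := min u T)) (Set.nonempty_Ioo.2 hu')
  refine ⟨k, ?_⟩
  rw [denseTimes, min_eq_left (hk.2.le.trans (min_le_right _ _))]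
  exact hsub ⟨hk.1, hk.2.trans_le (min_le_left _ _)⟩

/-- The probability that the number of particles at `x` reaches the level `c` before the time `T`
is, uniformly in the size of the box, controlled by the weight of the initial configuration. -/
lemma IsNaturalCoupling.measure_reach_le [IsProbabilityMeasure Q]
    (hη : IsNaturalCoupling κ w ν Q η) {q : Site d → ℝ} {T : ℝ≥0} (hq : IsGrowthRate κ w T q)
    {n : ℕ} (hn : 1 ≤ n) {x : Site d} (hx : x ∈ box d n) (c J : ℕ) :
    Q {ω | ∃ k, c + 1 ≤ η n (denseTimes T k) ω x} ≤
      ν {ξ | (J : ℝ) < weight (expWeight 1 q T) ξ.support ξ} + J * ((c + 1 : ℕ) : ℝ≥0∞)⁻¹ := by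
  have hX := hη.isProcessOn n hn
  set h := expWeight 1 q T with hh
  have hh0 : ∀ x, 0 ≤ h x := expWeight_nonneg zero_le_one _
  set B : Set Ω := {ω | ∃ k, c + 1 ≤ η n (denseTimes T k) ω x} with hB
  set A : Set Ω := {ω | weight h (η n 0 ω).support (η n 0 ω) ≤ J} with hAd
  have hA : MeasurableSet[history _ hX.measurable 0] A :=
    measurableSet_history hX.measurable 0 {ξ | weight h ξ.support ξ ≤ J}
  have hAc : Q Aᶜ = ν {ξ | (J : ℝ) < weight h ξ.support ξ} := by
    rw [← hX.initial, Measure.map_apply (hX.measurable 0) trivial]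
    congr 1
    ext ω
    simp [A]
  have hmax := hX.maximal_seq hq ((c + 1 : ℕ) : ℝ≥0∞) (denseTimes T) (fun k => min_le_right _ _) hA
  have hAB : A ∩ B ⊆ A ∩ {ω | ∃ k, ((c + 1 : ℕ) : ℝ≥0∞) ≤ ENNReal.ofReal
      (weight (expWeight 1 q (T - denseTimes T k)) (box d n) (η n (denseTimes T k) ω))} := by
    rintro ω ⟨hωA, k, hk⟩
    refine ⟨hωA, k, le_trans ?_ (particleNumber_le_weight (fun y => le_expWeight zero_le_one
      (sub_nonneg.2 (NNReal.coe_le_coe.2 (min_le_right _ _))) (hq.nonneg y)) _)⟩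
    calc ((c + 1 : ℕ) : ℝ≥0∞) ≤ (η n (denseTimes T k) ω x : ℝ≥0∞) := by exact_mod_cast hk
      _ ≤ _ := Finset.single_le_sum (f := fun y => (η n (denseTimes T k) ω y : ℝ≥0∞))
          (fun _ _ => zero_le) hx
  have hint : ∫⁻ ω in A, ENNReal.ofReal (weight h (box d n) (η n 0 ω)) ∂Q ≤ J := by
    calc _ ≤ ∫⁻ _ in A, (J : ℝ≥0∞) ∂Q := by
          refine setLIntegral_mono' ((history _ hX.measurable).le 0 _ hA) fun ω hω => ?_
          rw [← ENNReal.ofReal_natCast]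
          exact ENNReal.ofReal_le_ofReal ((weight_le_weight_support hh0 _ _).trans hω)
      _ ≤ J := by
          rw [setLIntegral_const]
          exact mul_le_of_le_one_right' prob_le_one
  have hABle : Q (A ∩ B) ≤ J * ((c + 1 : ℕ) : ℝ≥0∞)⁻¹ := by
    rw [← div_eq_mul_inv, ENNReal.le_div_iff_mul_le (Or.inl (by simp)) (Or.inl (by simp)), mul_comm]
    exact (mul_le_mul_right (measure_mono hAB) _).trans (hmax.trans hint)
  calc Q B ≤ Q (Aᶜ ∪ A ∩ B) := measure_mono fun ω hω => by
        by_cases h : ω ∈ A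
        · exact Or.inr ⟨h, hω⟩
        · exact Or.inl h
    _ ≤ Q Aᶜ + Q (A ∩ B) := measure_union_le _ _
    _ ≤ _ := add_le_add hAc.le hABle

/-- Almost surely, the number of particles at `x` is bounded on `[0, T)`, uniformly in the size of
the box. -/
lemma IsNaturalCoupling.ae_bounded [IsProbabilityMeasure ν] [IsProbabilityMeasure Q]
    (hη : IsNaturalCoupling κ w ν Q η) {q : Site d → ℝ} {T : ℝ≥0} (hq : IsGrowthRate κ w T q)
    {n₀ : ℕ} (hn₀ : 1 ≤ n₀) {x : Site d} (hx : x ∈ box d n₀) :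
    ∀ᵐ ω ∂Q, ∃ c : ℕ, ∀ m k, η (n₀ + m) (denseTimes T k) ω x < c + 1 := by
  set W : Config d → ℝ := fun ξ => weight (expWeight 1 q T) ξ.support ξ with hW
  let B : ℕ → ℕ → Set Ω := fun c m => {ω | ∃ k, c + 1 ≤ η (n₀ + m) (denseTimes T k) ω x}
  have hmono : ∀ᵐ ω ∂Q, ∀ k, MonotoneAt η (denseTimes T k) ω :=
    ae_all_iff.2 fun k => hη.ae_monotoneAt _
  have hunion : ∀ c J : ℕ, Q (⋃ m, B c m) ≤
      ν {ξ | (J : ℝ) < W ξ} + J * ((c + 1 : ℕ) : ℝ≥0∞)⁻¹ := by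
    intro c J
    rw [measure_iUnion_eq_iSup_accumulate]
    refine iSup_le fun m => le_trans (measure_mono_ae (t := B c m) ?_)
      (hη.measure_reach_le hq (by omega) (box_mono (by omega) hx) c J)
    filter_upwards [hmono] with ω hω h
    obtain ⟨i, hi, k, hk⟩ := Set.mem_accumulate.1 h
    exact ⟨k, hk.trans ((hω k).le (by omega) (by omega) (box_mono (by omega) hx))⟩
  have hnull : Q (⋂ c, ⋃ m, B c m) = 0 := by
    have h1 : ∀ J : ℕ, Q (⋂ c, ⋃ m, B c m) ≤ ν {ξ | (J : ℝ) < W ξ} := fun J => by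
      have hlim : Tendsto (fun c : ℕ => ν {ξ | (J : ℝ) < W ξ} + J * ((c + 1 : ℕ) : ℝ≥0∞)⁻¹) atTop
          (𝓝 (ν {ξ | (J : ℝ) < W ξ} + J * 0)) :=
        tendsto_const_nhds.add (ENNReal.Tendsto.const_mul
          (ENNReal.tendsto_inv_nat_nhds_zero.comp (tendsto_add_atTop_nat 1))
          (Or.inr (ENNReal.natCast_ne_top J)))
      rw [mul_zero, add_zero] at hlim
      exact ge_of_tendsto' hlim fun c => (measure_mono (Set.iInter_subset _ c)).trans (hunion c J)
    have h2 : Tendsto (fun J : ℕ => ν {ξ | (J : ℝ) < W ξ}) atTop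
        (𝓝 (ν (⋂ J : ℕ, {ξ | (J : ℝ) < W ξ}))) := by
      refine tendsto_measure_iInter_atTop (fun J => MeasurableSet.nullMeasurableSet trivial)
        (fun I J hIJ ξ hξ => ?_) ⟨0, measure_ne_top _ _⟩
      have hIJ' : (I : ℝ) ≤ J := by exact_mod_cast hIJ
      exact hIJ'.trans_lt hξ
    have h3 : (⋂ J : ℕ, {ξ | (J : ℝ) < W ξ}) = ∅ := by
      refine Set.eq_empty_of_forall_notMem fun ξ hξ => ?_
      obtain ⟨J, hJ⟩ := exists_nat_ge (W ξ)
      exact absurd (Set.mem_iInter.1 hξ J) (not_lt.2 hJ)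
    rw [h3, measure_empty] at h2
    exact le_antisymm (ge_of_tendsto' h2 h1) zero_le
  refine measure_mono_null (fun ω hω => ?_) hnull
  refine Set.mem_iInter.2 fun c => ?_
  by_contra hc
  refine hω ⟨c, fun m k => not_le.1 fun h => hc (Set.mem_iUnion.2 ⟨m, k, h⟩)⟩

/-- Right-continuity extends the bound from the countable set of times to all times. -/
theorem IsNaturalCoupling.noExplosion [IsProbabilityMeasure ν] [IsProbabilityMeasure Q]
    (hη : IsNaturalCoupling κ w ν Q η) (hq : ∀ T : ℝ≥0, ∃ q, IsGrowthRate κ w T q) :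
    NoExplosion Q η := by
  have hx : ∀ x : Site d, ∀ T : ℕ, ∀ᵐ ω ∂Q, ∀ t : ℝ≥0, t < T → limitProcess η t ω x < ⊤ := by
    intro x T
    obtain ⟨n₀, hn₀, hbox⟩ := exists_subset_box {x}
    have hxb : x ∈ box d n₀ := hbox (Finset.mem_singleton_self x)
    obtain ⟨q, hqT⟩ := hq T
    filter_upwards [hη.ae_bounded hqT hn₀ hxb] with ω hω t ht
    obtain ⟨c, hc⟩ := hω
    have hle : ∀ m, (η (n₀ + m) t ω x : ℕ∞) ≤ (c + 1 : ℕ) := fun m => by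
      obtain ⟨k, hk⟩ := exists_denseTimes ht
        ((hη.isProcessOn (n₀ + m) (by omega)).right_continuous ω t x)
      rw [← hk]
      exact_mod_cast (hc m k).le
    exact ((limitProcess_le_iSup t ω x n₀).trans (iSup_le hle)).trans_lt (ENat.natCast_lt_top _)
  filter_upwards [ae_all_iff.2 fun x => ae_all_iff.2 (hx x)] with ω hω x t
  obtain ⟨T, hT⟩ := exists_nat_gt t
  exact hω x T t hT

end Coupling

end ReactionDiffusion

end

theorem proposition1 {d : ℕ} (hd : 1 ≤ d) (κ : ℝ≥0) (w : ReactionDiffusion.Field d)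
    (hw : limsup (fun x : ReactionDiffusion.Site d =>
        (((w.vPlus x : ℝ) / (ReactionDiffusion.euclNorm x *
          Real.log (ReactionDiffusion.euclNorm x)) : ℝ) : EReal))
      (comap ReactionDiffusion.euclNorm atTop) = 0)
    (ν : Measure (ReactionDiffusion.Config d)) [IsProbabilityMeasure ν]
    (hν : ∀ᵐ ξ ∂ν, ξ ∈ w.states)
    {Ω : Type*} [MeasurableSpace Ω] (Q : Measure Ω) [IsProbabilityMeasure Q]
    (η : ℕ → ℝ≥0 → Ω → ReactionDiffusion.Config d)
    (hη : ReactionDiffusion.IsNaturalCoupling κ w ν Q η) :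
    (∀ (t : ℝ≥0) (ξ : ReactionDiffusion.Config d),
      ∫⁻ ω in {ω | ∀ x, ReactionDiffusion.limitProcess η 0 ω x = (ξ x : ℕ∞)},
        ReactionDiffusion.totalNumber η t ω ∂Q < ⊤) ∧
    ((∃ R : ℕ, ∀ᵐ ξ ∂ν, ∀ x ∉ ReactionDiffusion.box d R, ξ x = 0) →
      (∫⁻ ξ, (ξ.sum fun _ k => (k : ℝ≥0∞)) ∂ν < ⊤) →
      ∀ t : ℝ≥0, ∫⁻ ω, ReactionDiffusion.totalNumber η t ω ∂Q < ⊤) ∧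
    ReactionDiffusion.NoExplosion Q η := by
  refine ⟨fun t ξ => ?_, fun ⟨R, hR⟩ hfin t => ?_, ?_⟩
  · obtain ⟨q, hq⟩ := ReactionDiffusion.exists_isGrowthRate κ hw t
    exact hη.lintegral_totalNumber_lt_top_of_initial hq ξ
  · obtain ⟨q, hq⟩ := ReactionDiffusion.exists_isGrowthRate κ hw t
    exact hη.lintegral_totalNumber_lt_top hq hR hfin
  · exact hη.noExplosion (ReactionDiffusion.exists_isGrowthRate κ hw)
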